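/- **Model.** Let $\lambda,\mu,c,B>0$, $\bar p\in(0,1)$ and $T\in(0,\infty)$. Let $V:[0,\infty)\to\mathbb R$ be three times continuously differentiable with $V(0)=0$, $V'(\tau)>0$ and $-V''(\tau)/V'(\tau)\ge\bar p\lambda$ for all $\tau\ge 0$, and let $V(\infty):=\lim_{\tau\to\infty}V(\tau)$ exist with $V(\infty)>c/\mu$. An agent who exerts full effort chooses a measurable effort path $a:[0,T]\to[0,1]$, where $\tau$ is the time remaining until the deadline, $a_\tau$ is the share of effort put into doing and $1-a_\tau$ the share put into thinking. With $A_\tau=\int_\tau^T a_s\,ds$ and $p_\tau=\frac{\bar p e^{-\lambda A_\tau}}{\bar p e^{-\lambda A_\tau}+1-\bar p}$ she maximizes $$\int_0^T e^{-\mu(T-\tau-A_\tau)}\,(1-\bar p+\bar p e^{-\lambda A_\tau})\,\bigl(\mu(1-a_\tau)V(\tau)+\lambda a_\tau p_\tau B-c\bigr)\,d\tau .$$ **Notation.** Let $U(\tau)=(B-c/\lambda)(1-e^{-\lambda\tau})$, $\hat q(\tau)=\frac{\mu(V(\tau)+c\tau)}{\mu(B+c\tau)+(\lambda-\mu)(B-U(\tau))}$,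 $q(\tau)=\min\{1,\hat q(\tau)\}$, $$\dot y(s;p,\xi)=\mu V'(\xi+s)+p\mu\lambda(V(\xi+s)-B)+(\mu-\lambda p)c,\qquad \hat y(\tau;p,\xi)=\int_0^\tau e^{\mu s}\dot y(s;p,\xi)\,ds,$$ $\tau_1(x)=\frac1\lambda\ln\left(\frac{\bar p}{1-\bar p}\frac{1-q(x)}{q(x)}\right)$, and let $\tau_2(x)$ be the least $\tau>0$ with $\hat y(\tau;q(x),x)=0$ if there is a least one, and $\tau_2(x)=\infty$ otherwise. **Assumption.** (i) $V(\infty)\le B+c/\mu$. (ii) If $\mu>\lambda$, then $\tau\mapsto\frac{\mu V''(\tau)}{(\mu-\lambda)U''(\tau)}-\hat q(\tau)$ is monotonic on $[0,\infty)$. **Algorithm.** 1. Let $\bar\tau_3$ be the largest $x\ge 0$ such that $q(x-t)\le\frac{\bar p e^{-\lambda t}}{\bar p e^{-\lambda t}+1-\bar p}$ for all $t\in[0,x]$. If $\bar\tau_3\ge T$, return $\tau_1=\tau_2=0$, $\tau_3=T$. 2. Otherwise, if $q(\bar\tau_3)=\bar p$, $\tau_2(\bar\tau_3)\ge T-\bar\tau_3$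 and $\hat y(\tau;q(\bar\tau_3),\bar\tau_3)\ge0$ for all $\tau\in[0,T-\bar\tau_3]$, return $\tau_1=0$, $\tau_2=T-\bar\tau_3$, $\tau_3=\bar\tau_3$. 3. Otherwise, replace $\bar\tau_3$ by the largest $x\in[0,\bar\tau_3]$ such that $q(x-t)\le\frac{q(x)e^{-\lambda t}}{q(x)e^{-\lambda t}+1-q(x)}$ for all $t\in[0,x]$. Then lower $\tau_3$ continuously from $\bar\tau_3$ until $\tau_1(\tau_3)+\tau_2(\tau_3)+\tau_3=T$, that is, take the largest $\tau_3\in(0,\bar\tau_3]$ that solves this equation, and return $\tau_1=\tau_1(\tau_3)$, $\tau_2=\tau_2(\tau_3)$ and $\tau_3$. **Proposition (Optimal Policy – Characterization).** Under the Assumption, the algorithm stops and returns exactly one triple $(\tau_1,\tau_2,\tau_3)$. It satisfies $\tau_1,\tau_2\ge 0$, $\tau_3>0$ and $\tau_1+\tau_2+\tau_3=T$, and doing for a time $\tau_1$, then thinking for a time $\tau_2$, then doing for the last $\tau_3$ units of time is the unique optimal policy: it is optimal, and every optimal effort path agrees with it at almost every $\tau\in[0,T]$. -/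

import Mathlib

open Set Filter Topology MeasureTheory

noncomputable section

namespace DoingThinking

/-- The primitives of the problem: the arrival rate `lam` of a good doing arm, the arrival rate `mu`
of the thinking arm, the flow cost of effort `c`, the payoff `B` of a solution, the prior belief
`pbar` that the doing arm is good, the value `V τ` of progress with time `τ ≥ 0` remaining, and its
limit `Vinf` for a large time remaining. Their properties are listed in `Model.Standing`. -/
structure Model where
  lam : ℝ
  mu : ℝ
  c : ℝ
  B : ℝ
  pbar : ℝ
  V : ℝ → ℝ
  Vinf : ℝ

namespace Model

variable (M : Model)

/-- The first derivative of `V` on `[0, ∞)` (one-sided at `0`). -/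
def dV (τ : ℝ) : ℝ := derivWithin M.V (Ici 0) τ

/-- The second derivative of `V` on `[0, ∞)` (one-sided at `0`). -/
def ddV (τ : ℝ) : ℝ := derivWithin M.dV (Ici 0) τ

/-- The standing assumptions of the model. -/
structure Standing : Prop where
  lam_pos : 0 < M.lam
  mu_pos : 0 < M.mu
  c_pos : 0 < M.c
  B_pos : 0 < M.B
  pbar_pos : 0 < M.pbar
  pbar_lt_one : M.pbar < 1
  V_smooth : ContDiffOn ℝ 3 M.V (Ici 0)
  V_increasing : ∀ τ, 0 ≤ τ → 0 < M.dV τ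
  V_concave : ∀ τ, 0 ≤ τ → M.pbar * M.lam ≤ -M.ddV τ / M.dV τ
  V_zero : M.V 0 = 0
  V_limit : Tendsto M.V atTop (𝓝 M.Vinf)
  V_valuable : M.c / M.mu < M.Vinf

/-- The value of pulling for a time `τ` an arm that is known to have intensity `lam`. -/
def U (τ : ℝ) : ℝ := (M.B - M.c / M.lam) * (1 - Real.exp (-M.lam * τ))

/-- The ratio `q̂`, before it is capped at one. -/
def qhat (τ : ℝ) : ℝ :=
  M.mu * (M.V τ + M.c * τ) /
    (M.mu * (M.B + M.c * τ) +
      (M.lam - M.mu) * (M.B - (1 - Real.exp (-M.lam * τ)) * (M.B - M.c / M.lam)))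

/-- The belief `q τ` at which the agent enters the final doing period with time `τ` remaining. -/
def q (τ : ℝ) : ℝ := min 1 (M.qhat τ)

/-- The additional technical assumption on the primitives. -/
structure Regular : Prop where
  limit_le : M.Vinf ≤ M.B + M.c / M.mu
  monotonic : M.lam < M.mu →
    MonotoneOn (fun τ => M.mu * M.ddV τ / ((M.mu - M.lam) * deriv (deriv M.U) τ) - M.qhat τ)
      (Ici 0) ∨
    AntitoneOn (fun τ => M.mu * M.ddV τ / ((M.mu - M.lam) * deriv (deriv M.U) τ) - M.qhat τ)
      (Ici 0)

/-- The posterior belief about the doing arm when the prior is `p` and an amount `A` of doing has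
not led to a solution. -/
def posterior (p A : ℝ) : ℝ :=
  p * Real.exp (-M.lam * A) / (p * Real.exp (-M.lam * A) + 1 - p)

/-! ### The control problem

An effort path `a` is indexed by the time remaining `τ`, which runs down from `T` to `0`; `a τ` is
the share of the unit of effort put into doing, and `1 - a τ` the share put into thinking. -/

/-- The amount of past doing `A_τ` when `τ` is the time remaining. -/
def pastDoing (T : ℝ) (a : ℝ → ℝ) (τ : ℝ) : ℝ := ∫ s in τ..T, a s

/-- The admissible effort paths. -/
def Admissible (T : ℝ) (a : ℝ → ℝ) : Prop :=
  AEMeasurable a (volume.restrict (Icc 0 T)) ∧ ∀ τ ∈ Icc 0 T, a τ ∈ Icc (0 : ℝ) 1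

/-- The expected flow payoff with time `τ` remaining, past doing `A` and current effort `x` on the
doing arm. -/
def flow (x A τ : ℝ) : ℝ :=
  M.mu * (1 - x) * M.V τ + M.lam * x * M.posterior M.pbar A * M.B - M.c

/-- The expected payoff of an effort path: the flow payoff weighted by the probability that neither
progress nor a solution has arrived. -/
def payoff (T : ℝ) (a : ℝ → ℝ) : ℝ :=
  ∫ τ in (0 : ℝ)..T,
    Real.exp (-M.mu * (T - τ - pastDoing T a τ)) *
      (1 - M.pbar + M.pbar * Real.exp (-M.lam * pastDoing T a τ)) *
      M.flow (a τ) (pastDoing T a τ) τ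

/-- `a` maximizes the expected payoff among all admissible effort paths. -/
def IsOptimal (T : ℝ) (a : ℝ → ℝ) : Prop :=
  Admissible T a ∧ ∀ b, Admissible T b → M.payoff T b ≤ M.payoff T a

/-- The effort path that does, thinks for a period of length `τ₂`, and does again during the last
`τ₃` units of time. -/
def policy (τ₂ τ₃ : ℝ) (τ : ℝ) : ℝ :=
  if τ < τ₃ then 1 else if τ < τ₃ + τ₂ then 0 else 1

/-! ### The algorithm -/

/-- The slope `ẏ (s; p, ξ)` of the relative preference for thinking. -/
def ydot (s p ξ : ℝ) : ℝ :=
  M.mu * M.dV (ξ + s) + p * M.mu * M.lam * (M.V (s + ξ) - M.B) + (M.mu - M.lam * p) * M.c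

/-- The relative preference for thinking `ŷ (τ; p, ξ)`. -/
def yhat (τ p ξ : ℝ) : ℝ := ∫ s in (0 : ℝ)..τ, Real.exp (M.mu * s) * M.ydot s p ξ

/-- The length of the initial doing period as a function of the length of the final one; it is used
only for `0 < q τ₃ < 1`. -/
def len₁ (τ₃ : ℝ) : ℝ :=
  1 / M.lam * Real.log (M.pbar / (1 - M.pbar) * ((1 - M.q τ₃) / M.q τ₃))

/-- The positive roots of `ŷ (· ; q τ₃, τ₃)`. -/
def roots (τ₃ : ℝ) : Set ℝ := {τ | 0 < τ ∧ M.yhat τ (M.q τ₃) τ₃ = 0}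

open Classical in
/-- The length of the thinking period as a function of the length of the final doing period: the
least positive root of `ŷ`, and `∞` if there is none. -/
def len₂ (τ₃ : ℝ) : EReal :=
  if h : ∃ τ, IsLeast (M.roots τ₃) τ then ((Classical.choose h : ℝ) : EReal) else ⊤

/-- The lengths `x` such that doing throughout the last `x` units of time, starting from the prior,
keeps the belief weakly above `q`. -/
def doOnly : Set ℝ :=
  {x | 0 ≤ x ∧ ∀ t ∈ Icc 0 x, M.q (x - t) ≤ M.posterior M.pbar t}

/-- The lengths `x` such that doing throughout the last `x` units of time, starting from the belief
`q x`, keeps the belief weakly above `q`. -/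
def hailMary : Set ℝ :=
  {x | 0 ≤ x ∧ ∀ t ∈ Icc 0 x, M.q (x - t) ≤ M.posterior (M.q x) t}

/-- Thinking as long as more than `x` units of time remain, followed by a final doing period of
length `x`, passes the test of the algorithm. -/
def ThinkFirst (T x : ℝ) : Prop :=
  M.q x = M.pbar ∧ ((T - x : ℝ) : EReal) ≤ M.len₂ x ∧
    ∀ τ ∈ Icc 0 (T - x), 0 ≤ M.yhat τ (M.q x) x

/-- The lengths of the final doing period that solve the fixed-point equation. -/
def fixedPoints (T : ℝ) : Set ℝ :=
  {x | 0 < x ∧ (M.len₁ x : EReal) + M.len₂ x + (x : EReal) = (T : EReal)}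

/-- The algorithm stops and returns the lengths `τ₁`, `τ₂` and `τ₃`. Here `m` is the largest final
doing period that can start at the prior. If `m ≥ T`, the agent does throughout. Otherwise, if the
test `ThinkFirst` is passed, she thinks first. Otherwise `m` is replaced by the largest element `m₁`
of `hailMary` up to `m`, which is then lowered continuously until the fixed-point equation holds,
that is, to the largest fixed point up to `m₁`. -/
def Returns (T τ₁ τ₂ τ₃ : ℝ) : Prop :=
  ∃ m, IsGreatest M.doOnly m ∧
    ((T ≤ m ∧ τ₁ = 0 ∧ τ₂ = 0 ∧ τ₃ = T) ∨
     (m < T ∧ M.ThinkFirst T m ∧ τ₁ = 0 ∧ τ₂ = T - m ∧ τ₃ = m) ∨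
     (m < T ∧ ¬ M.ThinkFirst T m ∧
        ∃ m₁, IsGreatest (M.hailMary ∩ Iic m) m₁ ∧
          IsGreatest (M.fixedPoints T ∩ Iic m₁) τ₃ ∧
          τ₁ = M.len₁ τ₃ ∧ (τ₂ : EReal) = M.len₂ τ₃))

end Model

end DoingThinking

end

open Set Filter Topology MeasureTheory

noncomputable section

namespace DoingThinking

namespace Model

variable {M : Model}

/-! ### A globally differentiable extension of the value of progress -/

/-! Compare every path with doing until the deadline. Differentiating the continuation value of that
plan along a path shows (`Standing.payoff_eq`) that the payoff is a constant plus the integral of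
e^{-μθ} · `gap` (A, τ) · (1 - b), where θ is past thinking and A past doing. Thus only the moments
of thinking count, and each is valued by `gap`, whose sign compares `q` τ with the current belief.

While the agent does, A + τ is constant and `gap` changes at a rate proportional to -`slope`. The
slope strictly decreases in the belief, because V < B + c/μ, and weakly decreases in τ for beliefs
up to the prior, by the curvature bound on V. So it increases strictly under doing and weakly under
thinking, and changes sign at most once along a path. Let α be the past doing at the change of sign.
Moving each unit of thinking, with θ fixed, along its doing line to past doing α can only raise
`gap` (`gap_lt_of_crossing`). Hence every path is dominated by one that does for α, thinks for Θ and
does again, and equality forces the path to have this form (`exists_payoff_le`, `ae_eq_policy`).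

What remains is to maximize the continuous function `gain` over a compact triangle. At a maximizer
with Θ > 0 and final period x, the condition in Θ is `gap` α x = 0, that is, `q` x equals the
belief; the condition in α is ŷ ≥ 0, with equality if α > 0. By `stationary_unique`, a point
satisfying these conditions with ŷ = 0 excludes another with a longer final period. So no larger
fixed point and no think-first candidate can mislead the algorithm, which returns every maximizer
(`returns_of_isMaxGain`). Since its output is unique, all optimal paths agree almost everywhere. -/

variable (M) in
/-- The extension of `V` to the real line by a linear function on the negative half-line. -/
def Vext (τ : ℝ) : ℝ := ∫ s in (0 : ℝ)..τ, M.dV (max s 0)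

namespace Standing

variable (hM : M.Standing)
include hM

theorem contDiffOn_dV : ContDiffOn ℝ 2 M.dV (Ici 0) :=
  hM.V_smooth.derivWithin (uniqueDiffOn_Ici 0) (by norm_num)

theorem continuous_dV_max : Continuous fun τ => M.dV (max τ 0) :=
  hM.contDiffOn_dV.continuousOn.comp_continuous (by fun_prop) fun τ => le_max_right τ 0

theorem hasDerivAt_V {τ : ℝ} (hτ : 0 < τ) : HasDerivAt M.V (M.dV τ) τ :=
  ((hM.V_smooth.differentiableOn (by norm_num) τ hτ.le).hasDerivWithinAt).hasDerivAt
    (Ici_mem_nhds hτ)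

theorem hasDerivAt_dV {τ : ℝ} (hτ : 0 < τ) : HasDerivAt M.dV (M.ddV τ) τ :=
  ((hM.contDiffOn_dV.differentiableOn (by norm_num) τ hτ.le).hasDerivWithinAt).hasDerivAt
    (Ici_mem_nhds hτ)

theorem hasDerivAt_Vext (τ : ℝ) : HasDerivAt M.Vext (M.dV (max τ 0)) τ :=
  hM.continuous_dV_max.integral_hasStrictDerivAt 0 τ |>.hasDerivAt

theorem continuous_Vext : Continuous M.Vext :=
  continuous_iff_continuousAt.2 fun τ => (hM.hasDerivAt_Vext τ).continuousAt

theorem Vext_eq {τ : ℝ} (hτ : 0 ≤ τ) : M.Vext τ = M.V τ := by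
  have h : ∫ s in (0 : ℝ)..τ, M.dV (max s 0) = M.V τ - M.V 0 := by
    refine intervalIntegral.integral_eq_sub_of_hasDerivAt_of_le hτ
      (hM.V_smooth.continuousOn.mono Icc_subset_Ici_self) (fun s hs => ?_)
      (hM.continuous_dV_max.intervalIntegrable _ _)
    rw [max_eq_left hs.1.le]
    exact hM.hasDerivAt_V hs.1
  rw [Vext, h, hM.V_zero, sub_zero]

theorem strictMonoOn_V : StrictMonoOn M.V (Ici 0) := by
  refine strictMonoOn_of_deriv_pos (convex_Ici 0) hM.V_smooth.continuousOn fun τ hτ => ?_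
  rw [interior_Ici] at hτ
  rw [(hM.hasDerivAt_V hτ).deriv]
  exact hM.V_increasing τ (le_of_lt hτ)

theorem V_lt_Vinf {τ : ℝ} (hτ : 0 ≤ τ) : M.V τ < M.Vinf := by
  have h1 : M.V τ < M.V (τ + 1) := hM.strictMonoOn_V hτ (by simp; linarith) (by linarith)
  refine h1.trans_le (ge_of_tendsto hM.V_limit ?_)
  filter_upwards [eventually_ge_atTop (τ + 1)] with s hs
  exact hM.strictMonoOn_V.monotoneOn (by simp; linarith) (by simp; linarith) hs

theorem V_nonneg {τ : ℝ} (hτ : 0 ≤ τ) : 0 ≤ M.V τ := by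
  rw [← hM.V_zero]
  exact hM.strictMonoOn_V.monotoneOn (by simp) hτ hτ

end Standing

/-! ### Beliefs -/

variable (M) in
/-- The probability that an amount `A` of doing has not led to a solution. -/
def survival (A : ℝ) : ℝ := M.pbar * Real.exp (-M.lam * A) + 1 - M.pbar

theorem posterior_eq (A : ℝ) :
    M.posterior M.pbar A = M.pbar * Real.exp (-M.lam * A) / M.survival A := rfl

theorem posterior_zero : M.posterior M.pbar 0 = M.pbar := by
  simp [posterior_eq, survival]

theorem continuous_survival : Continuous M.survival := by unfold survival; fun_prop

theorem hasDerivAt_exp_neg (r A : ℝ) :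
    HasDerivAt (fun A => Real.exp (-r * A)) (-r * Real.exp (-r * A)) A := by
  simpa [mul_comm] using ((hasDerivAt_id A).const_mul (-r)).exp

namespace Standing

variable (hM : M.Standing)
include hM

theorem survival_pos (A : ℝ) : 0 < M.survival A := by
  have := mul_pos hM.pbar_pos (Real.exp_pos (-M.lam * A))
  have := hM.pbar_lt_one
  rw [survival]; linarith

theorem posterior_mul_survival (A : ℝ) :
    M.posterior M.pbar A * M.survival A = M.pbar * Real.exp (-M.lam * A) :=
  div_mul_cancel₀ _ (hM.survival_pos A).ne'

theorem posterior_pos (A : ℝ) : 0 < M.posterior M.pbar A :=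
  div_pos (mul_pos hM.pbar_pos (Real.exp_pos _)) (hM.survival_pos A)

theorem posterior_lt_one (A : ℝ) : M.posterior M.pbar A < 1 := by
  rw [posterior_eq, div_lt_one (hM.survival_pos A), survival]
  linarith [hM.pbar_lt_one]

theorem posterior_strictAnti : StrictAnti (M.posterior M.pbar) := by
  intro A A' h
  have he : Real.exp (-M.lam * A') < Real.exp (-M.lam * A) :=
    Real.exp_lt_exp.2 (by nlinarith [hM.lam_pos])
  rw [posterior_eq, posterior_eq, div_lt_div_iff₀ (hM.survival_pos _) (hM.survival_pos _),
    survival, survival]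
  nlinarith [mul_pos hM.pbar_pos (sub_pos.2 hM.pbar_lt_one)]

theorem posterior_le {A : ℝ} (hA : 0 ≤ A) : M.posterior M.pbar A ≤ M.pbar :=
  (hM.posterior_strictAnti.antitone hA).trans_eq posterior_zero

theorem posterior_lt {A : ℝ} (hA : 0 < A) : M.posterior M.pbar A < M.pbar :=
  (hM.posterior_strictAnti hA).trans_eq posterior_zero

/-- Bayesian updating composes, so a final period started at belief `q x`, as in `hailMary`, can be
treated as doing started from the prior. -/
theorem posterior_posterior (A t : ℝ) :
    M.posterior (M.posterior M.pbar A) t = M.posterior M.pbar (A + t) := by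
  have h : Real.exp (-M.lam * (A + t)) = Real.exp (-M.lam * A) * Real.exp (-M.lam * t) := by
    rw [← Real.exp_add]; ring_nf
  have h1 := (hM.survival_pos A).ne'
  have h2 := (hM.survival_pos (A + t)).ne'
  have h3 : M.posterior M.pbar A * Real.exp (-M.lam * t) + 1 - M.posterior M.pbar A
      = M.survival (A + t) / M.survival A := by
    rw [posterior_eq, eq_div_iff h1]
    field_simp
    simp only [survival, h]
    ring_nf
  rw [posterior, h3, posterior_eq, posterior_eq, h]
  field_simp

theorem continuous_posterior : Continuous (M.posterior M.pbar) :=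
  Continuous.div (by fun_prop) continuous_survival fun A => (hM.survival_pos A).ne'

end Standing

/-! ### The slope of the relative preference for thinking -/

variable (M) in
/-- The slope `ẏ` as a function of the belief and of the time remaining. -/
def slope (p τ : ℝ) : ℝ :=
  M.mu * (M.dV (max τ 0) + M.c) + M.lam * p * (M.mu * (M.Vext τ - M.B) - M.c)

namespace Standing

variable (hM : M.Standing)
include hM

theorem ydot_eq {s ξ : ℝ} (p : ℝ) (h : 0 ≤ ξ + s) : M.ydot s p ξ = M.slope p (ξ + s) := by
  rw [slope, max_eq_left h, hM.Vext_eq h, ydot, add_comm s ξ]; ring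

theorem continuous_slope : Continuous fun z : ℝ × ℝ => M.slope z.1 z.2 := by
  have h1 : Continuous fun z : ℝ × ℝ => M.dV (max z.2 0) :=
    hM.continuous_dV_max.comp continuous_snd
  have h2 : Continuous fun z : ℝ × ℝ => M.Vext z.2 := hM.continuous_Vext.comp continuous_snd
  unfold slope
  fun_prop

theorem continuous_slope_right (p : ℝ) : Continuous (M.slope p) :=
  hM.continuous_slope.comp (by fun_prop : Continuous fun τ : ℝ => (p, τ))

/-- The coefficient of p is λ(μ(V - B) - c), which is negative because V stays strictly below its
limit, hence below B + c/μ. -/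
theorem slope_strictAnti_left (hR : M.Regular) {τ : ℝ} (hτ : 0 ≤ τ) :
    StrictAnti fun p => M.slope p τ := by
  intro p p' h
  have h1 : M.V τ < M.B + M.c / M.mu := (hM.V_lt_Vinf hτ).trans_le hR.limit_le
  have h2 : M.mu * (M.V τ - M.B) - M.c < 0 := by
    have := mul_lt_mul_of_pos_left h1 hM.mu_pos
    rw [mul_add, mul_div_cancel₀ _ hM.mu_pos.ne'] at this
    linarith
  simp only [slope, hM.Vext_eq hτ]
  nlinarith [mul_pos hM.lam_pos (sub_pos.2 h)]

theorem hasDerivAt_slope (p : ℝ) {τ : ℝ} (hτ : 0 < τ) :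
    HasDerivAt (M.slope p) (M.mu * (M.ddV τ + M.lam * p * M.dV τ)) τ := by
  have h1 : HasDerivAt (fun τ => M.dV (max τ 0)) (M.ddV τ) τ :=
    (hM.hasDerivAt_dV hτ).congr_of_eventuallyEq (by
      filter_upwards [Ioi_mem_nhds hτ] with s hs
      rw [max_eq_left (le_of_lt hs)])
  have h2 := hM.hasDerivAt_Vext τ
  rw [max_eq_left hτ.le] at h2
  convert! ((h1.add_const M.c).const_mul M.mu).add
    ((((h2.sub_const M.B).const_mul M.mu).sub_const M.c).const_mul (M.lam * p)) using 1
  ring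

theorem ddV_le {τ : ℝ} (hτ : 0 ≤ τ) : M.ddV τ ≤ -(M.pbar * M.lam * M.dV τ) := by
  have h := hM.V_concave τ hτ
  rw [le_div_iff₀ (hM.V_increasing τ hτ)] at h
  linarith

/-- The derivative is μ(V'' + λpV') and V'' ≤ -p̄λV'. At p = p̄ this gives only weak monotonicity,
which is why beliefs at and below the prior are treated apart later. -/
theorem slope_antitoneOn {p : ℝ} (hp : p ≤ M.pbar) : AntitoneOn (M.slope p) (Ici 0) := by
  refine antitoneOn_of_deriv_nonpos (convex_Ici 0) (hM.continuous_slope_right p).continuousOn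
    (fun τ hτ => ?_) fun τ hτ => ?_ <;> rw [interior_Ici] at hτ
  · exact (hM.hasDerivAt_slope p hτ).differentiableAt.differentiableWithinAt
  · rw [(hM.hasDerivAt_slope p hτ).deriv]
    have h1 := hM.ddV_le (le_of_lt hτ)
    have h2 := mul_pos hM.lam_pos (hM.V_increasing τ (le_of_lt hτ))
    refine mul_nonpos_of_nonneg_of_nonpos hM.mu_pos.le ?_
    nlinarith

theorem slope_strictAntiOn {p : ℝ} (hp : p < M.pbar) : StrictAntiOn (M.slope p) (Ici 0) := by
  refine strictAntiOn_of_deriv_neg (convex_Ici 0) (hM.continuous_slope_right p).continuousOn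
    fun τ hτ => ?_
  rw [interior_Ici] at hτ
  rw [(hM.hasDerivAt_slope p hτ).deriv]
  have h1 := hM.ddV_le (le_of_lt hτ)
  have h2 := mul_pos hM.lam_pos (hM.V_increasing τ (le_of_lt hτ))
  refine mul_neg_of_pos_of_neg hM.mu_pos ?_
  nlinarith

/-- The slope increases strictly along doing. -/
theorem slope_posterior_lt (hR : M.Regular) {A A' τ τ' : ℝ} (hA : 0 ≤ A) (hAA : A < A')
    (hτ : 0 ≤ τ') (hττ : τ' ≤ τ) :
    M.slope (M.posterior M.pbar A) τ < M.slope (M.posterior M.pbar A') τ' :=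
  (hM.slope_antitoneOn (hM.posterior_le hA) hτ (hτ.trans hττ) hττ).trans_lt
    (hM.slope_strictAnti_left hR hτ (hM.posterior_strictAnti hAA))

end Standing

/-! ### The gain from thinking before a final doing period -/

variable (M) in
/-- The denominator of `q̂`. -/
def denom (τ : ℝ) : ℝ :=
  M.mu * (M.B + M.c * τ) +
    (M.lam - M.mu) * (M.B - (1 - Real.exp (-M.lam * τ)) * (M.B - M.c / M.lam))

variable (M) in
/-- The marginal gain, weighted by the probability that doing has failed, from thinking a little
before doing until the deadline, after past doing `A` and with time `τ` remaining. -/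
def gap (A τ : ℝ) : ℝ :=
  M.survival A * (M.mu * (M.Vext τ + M.c * τ)) - M.pbar * Real.exp (-M.lam * A) * M.denom τ

theorem hasDerivAt_survival (A : ℝ) :
    HasDerivAt M.survival (-(M.lam * (M.pbar * Real.exp (-M.lam * A)))) A := by
  convert! (((hasDerivAt_exp_neg M.lam A).const_mul M.pbar).add_const 1).sub_const M.pbar using 1
  ring

theorem continuous_denom : Continuous M.denom := by unfold denom; fun_prop

namespace Standing

variable (hM : M.Standing)
include hM

theorem hasDerivAt_denom (τ : ℝ) :
    HasDerivAt M.denom (M.mu * M.c + (M.mu - M.lam) *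
      ((M.lam * M.B - M.c) * Real.exp (-M.lam * τ))) τ := by
  have h1 := (((hasDerivAt_id τ).const_mul M.c).const_add M.B).const_mul M.mu
  have h2 := ((((hasDerivAt_exp_neg M.lam τ).const_sub 1).mul_const
    (M.B - M.c / M.lam)).const_sub M.B).const_mul (M.lam - M.mu)
  convert! h1.add h2 using 1
  have := hM.lam_pos.ne'
  field_simp
  ring

theorem denom_pos {τ : ℝ} (hτ : 0 ≤ τ) : 0 < M.denom τ := by
  have hl := hM.lam_pos
  set e := Real.exp (-M.lam * τ) with he
  have h1 : 0 < e := Real.exp_pos _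
  have h2 : 1 - e ≤ M.lam * τ := by
    have := Real.add_one_le_exp (-M.lam * τ)
    linarith
  have h3 : 0 ≤ 1 - e := by
    have : e ≤ 1 := Real.exp_le_one_iff.2 (by nlinarith)
    linarith
  -- Regrouped into nonnegative terms by means of 0 ≤ 1 - e ≤ λτ; the term λBe is strictly positive.
  have h4 : M.denom τ = M.mu * ((1 - e) * M.B + M.c / M.lam * (M.lam * τ - (1 - e)))
      + M.lam * (M.B * e) + M.c * (1 - e) := by
    rw [denom, ← he]
    field_simp
    ring
  have h5 : 0 ≤ (1 - e) * M.B := mul_nonneg h3 hM.B_pos.le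
  have h6 : 0 ≤ M.c / M.lam * (M.lam * τ - (1 - e)) :=
    mul_nonneg (div_pos hM.c_pos hl).le (sub_nonneg.2 h2)
  have h7 : 0 < M.lam * (M.B * e) := mul_pos hl (mul_pos hM.B_pos h1)
  have h8 : 0 ≤ M.c * (1 - e) := mul_nonneg hM.c_pos.le h3
  have h9 := mul_nonneg hM.mu_pos.le (add_nonneg h5 h6)
  rw [h4]
  linarith

theorem continuous_gap : Continuous fun z : ℝ × ℝ => M.gap z.1 z.2 := by
  have h1 : Continuous fun z : ℝ × ℝ => M.survival z.1 := continuous_survival.comp continuous_fst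
  have h2 : Continuous fun z : ℝ × ℝ => M.Vext z.2 := hM.continuous_Vext.comp continuous_snd
  have h3 : Continuous fun z : ℝ × ℝ => M.denom z.2 := continuous_denom.comp continuous_snd
  unfold gap
  fun_prop

/-- This links the control problem to the algorithm: the sign of the marginal gain is that of q̂
minus the belief. The cap in `q` is harmless because posteriors are below one. -/
theorem gap_eq {A τ : ℝ} (hτ : 0 ≤ τ) :
    M.gap A τ = M.survival A * M.denom τ * (M.qhat τ - M.posterior M.pbar A) := by
  have h : M.qhat τ * M.denom τ = M.mu * (M.V τ + M.c * τ) :=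
    div_mul_cancel₀ _ (hM.denom_pos hτ).ne'
  rw [gap, ← hM.posterior_mul_survival, hM.Vext_eq hτ, ← h]
  ring

theorem gap_nonpos_iff {A τ : ℝ} (hτ : 0 ≤ τ) :
    M.gap A τ ≤ 0 ↔ M.q τ ≤ M.posterior M.pbar A := by
  rw [hM.gap_eq hτ, mul_nonpos_iff_pos_imp_nonpos, q, min_le_iff]
  have h := mul_pos (hM.survival_pos A) (hM.denom_pos hτ)
  have h1 := hM.posterior_lt_one A
  constructor
  · intro h2; exact Or.inr (by linarith [h2.1 h])
  · rintro (h2 | h2)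
    · linarith
    · exact ⟨fun _ => by linarith, fun h3 => h.le⟩

theorem gap_eq_zero_iff {A τ : ℝ} (hτ : 0 ≤ τ) :
    M.gap A τ = 0 ↔ M.q τ = M.posterior M.pbar A := by
  have h := (mul_pos (hM.survival_pos A) (hM.denom_pos hτ)).ne'
  have h1 := hM.posterior_lt_one A
  rw [hM.gap_eq hτ, mul_eq_zero, or_iff_right h, sub_eq_zero, q]
  constructor
  · intro h2; rw [h2]; exact min_eq_right h1.le
  · intro h2
    rcases min_choice 1 (M.qhat τ) with h3 | h3 <;> rw [h3] at h2
    · linarith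
    · exact h2

/-- Progress at the deadline is worthless, as V(0) = 0. This keeps an optimal thinking period from
reaching the deadline. -/
theorem gap_zero_neg (A : ℝ) : M.gap A 0 < 0 := by
  have h1 := mul_pos (mul_pos hM.pbar_pos (Real.exp_pos (-M.lam * A))) (hM.denom_pos le_rfl)
  rw [gap, hM.Vext_eq le_rfl, hM.V_zero]
  linarith

theorem q_nonneg {τ : ℝ} (hτ : 0 ≤ τ) : 0 ≤ M.q τ := by
  refine le_min zero_le_one (div_nonneg (mul_nonneg hM.mu_pos.le ?_) (hM.denom_pos hτ).le)
  have := hM.V_nonneg hτ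
  have := mul_nonneg hM.c_pos.le hτ
  linarith

theorem q_pos {τ : ℝ} (hτ : 0 < τ) : 0 < M.q τ := by
  refine lt_min zero_lt_one (div_pos (mul_pos hM.mu_pos ?_) (hM.denom_pos hτ.le))
  have := hM.V_nonneg hτ.le
  have := mul_pos hM.c_pos hτ
  linarith

theorem q_zero : M.q 0 = 0 := by
  simp [q, qhat, hM.V_zero]

theorem continuousOn_q : ContinuousOn M.q (Ici 0) := by
  have h : ContinuousOn M.qhat (Ici 0) :=
    ContinuousOn.div (by have := hM.V_smooth.continuousOn; fun_prop)
      continuous_denom.continuousOn fun τ hτ => (hM.denom_pos hτ).ne'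
  exact (continuous_const.min continuous_id).comp_continuousOn h

/-- The derivative of the gap along doing, when past doing plus time remaining are constant. -/
theorem hasDerivAt_gap_doing (k A : ℝ) :
    HasDerivAt (fun A => M.gap A (k - A))
      (-(M.survival A * M.slope (M.posterior M.pbar A) (k - A))) A := by
  have hk : HasDerivAt (fun A => k - A) (-1) A := by simpa using (hasDerivAt_id A).const_sub k
  have h1 := (hM.hasDerivAt_Vext (k - A)).comp A hk
  have h2 := (hM.hasDerivAt_denom (k - A)).comp A hk
  have h3 := (hasDerivAt_exp_neg M.lam A).const_mul M.pbar
  have h4 := (hasDerivAt_survival (M := M) A).mul ((h1.add (hk.const_mul M.c)).const_mul M.mu)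
  convert! h4.sub (h3.mul h2) using 1
  have h5 : M.survival A * M.slope (M.posterior M.pbar A) (k - A)
      = M.survival A * (M.mu * (M.dV (max (k - A) 0) + M.c)) + M.lam *
        (M.pbar * Real.exp (-M.lam * A)) * (M.mu * (M.Vext (k - A) - M.B) - M.c) := by
    rw [← hM.posterior_mul_survival, slope]; ring
  rw [h5]
  simp only [Function.comp_apply, Pi.add_apply, denom]
  have := hM.lam_pos.ne'
  field_simp
  ring

/-- The derivative of the rescaled gap along thinking. -/
theorem hasDerivAt_gap_thinking (A τ : ℝ) :
    HasDerivAt (fun τ => Real.exp (M.lam * M.posterior M.pbar A * τ) * M.gap A τ)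
      (Real.exp (M.lam * M.posterior M.pbar A * τ) *
        (M.survival A * (M.slope (M.posterior M.pbar A) τ +
          M.lam * M.posterior M.pbar A * (1 - M.posterior M.pbar A) * M.denom τ))) τ := by
  have h1 := (hM.hasDerivAt_Vext τ).add ((hasDerivAt_id τ).const_mul M.c)
  have h2 := ((h1.const_mul M.mu).const_mul (M.survival A)).sub
    ((hM.hasDerivAt_denom τ).const_mul (M.pbar * Real.exp (-M.lam * A)))
  -- The integrating factor adds λp · `gap` to the derivative. Since `denom`' + λ · `denom` = λ(μ(B
  -- + cτ) + c), only the slope and a positive multiple of `denom` remain.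
  have h3 : HasDerivAt (fun τ => Real.exp (M.lam * M.posterior M.pbar A * τ))
      (Real.exp (M.lam * M.posterior M.pbar A * τ) * (M.lam * M.posterior M.pbar A)) τ := by
    simpa using ((hasDerivAt_id τ).const_mul (M.lam * M.posterior M.pbar A)).exp
  convert! h3.mul h2 using 1
  simp only [← hM.posterior_mul_survival, slope, denom, Pi.add_apply, Pi.sub_apply, id]
  generalize M.posterior M.pbar A = p
  generalize Real.exp (M.lam * p * τ) = x
  generalize Real.exp (-M.lam * τ) = y
  have := hM.lam_pos.ne'
  field_simp
  ring

/-- If the agent weakly prefers doing and the slope is nonnegative, then she strictly prefers to go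
on with doing. -/
theorem gap_doing_neg (hR : M.Regular) {A τ r : ℝ} (hA : 0 ≤ A) (hr : 0 < r) (hrτ : r ≤ τ)
    (hs : 0 ≤ M.slope (M.posterior M.pbar A) τ) (hg : M.gap A τ ≤ 0) :
    M.gap (A + r) (τ - r) < 0 := by
  have h : StrictAntiOn (fun x => M.gap x (A + τ - x)) (Icc A (A + τ)) := by
    refine strictAntiOn_of_deriv_neg (convex_Icc _ _)
      (fun x _ => (hM.hasDerivAt_gap_doing _ x).continuousAt.continuousWithinAt) fun x hx => ?_
    rw [interior_Icc] at hx
    rw [(hM.hasDerivAt_gap_doing _ x).deriv, neg_lt_zero]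
    refine mul_pos (hM.survival_pos x) (hs.trans_lt ?_)
    exact hM.slope_posterior_lt hR hA hx.1 (by linarith [hx.2]) (by linarith [hx.1])
  have h1 := h ⟨le_rfl, by linarith⟩ (b := A + r) ⟨by linarith, by linarith⟩ (by linarith)
  simp only [add_sub_cancel_left, add_sub_add_left_eq_sub] at h1
  linarith

/-- If the agent weakly prefers thinking, then so she does, strictly, with more time remaining as
long as the slope is nonnegative. -/
theorem gap_thinking_pos {A x x' : ℝ} (hA : 0 ≤ A) (hx : 0 ≤ x) (hxx : x < x')
    (hs : 0 ≤ M.slope (M.posterior M.pbar A) x') (hg : 0 ≤ M.gap A x) : 0 < M.gap A x' := by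
  have h : StrictMonoOn (fun τ => Real.exp (M.lam * M.posterior M.pbar A * τ) * M.gap A τ)
      (Icc x x') := by
    refine strictMonoOn_of_deriv_pos (convex_Icc _ _)
      (fun τ _ => (hM.hasDerivAt_gap_thinking A τ).continuousAt.continuousWithinAt) fun τ hτ => ?_
    rw [interior_Icc] at hτ
    rw [(hM.hasDerivAt_gap_thinking A τ).deriv]
    have h0 : 0 ≤ τ := by linarith [hτ.1]
    have h1 : 0 ≤ M.slope (M.posterior M.pbar A) τ :=
      hs.trans (hM.slope_antitoneOn (hM.posterior_le hA) h0 (hx.trans hxx.le) hτ.2.le)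
    have h2 : 0 < M.lam * M.posterior M.pbar A * (1 - M.posterior M.pbar A) * M.denom τ :=
      mul_pos (mul_pos (mul_pos hM.lam_pos (hM.posterior_pos A))
        (sub_pos.2 (hM.posterior_lt_one A))) (hM.denom_pos h0)
    exact mul_pos (Real.exp_pos _) (mul_pos (hM.survival_pos A) (by linarith))
  have h1 := h ⟨le_rfl, hxx.le⟩ ⟨hxx.le, le_rfl⟩ hxx
  have h2 := mul_nonneg (Real.exp_pos (M.lam * M.posterior M.pbar A * x)).le hg
  exact pos_of_mul_pos_right (h2.trans_lt h1) (Real.exp_pos _).le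

/-- Among the effort paths that pass through past doing `A₀` with time `τ₀` remaining, where the
slope changes sign, thinking is most valuable at past doing `A₀`. -/
theorem gap_lt_of_crossing (hR : M.Regular) {A₀ τ₀ A τ : ℝ} (hA₀ : 0 ≤ A₀) (hA : 0 ≤ A)
    (hτ : 0 ≤ τ) (hne : A ≠ A₀)
    (hlate : A₀ < A → 0 ≤ M.slope (M.posterior M.pbar A₀) τ₀ ∧ A + τ ≤ A₀ + τ₀)
    (hearly : A < A₀ → M.slope (M.posterior M.pbar A₀) τ₀ ≤ 0 ∧ A₀ + τ₀ ≤ A + τ ∧ 0 ≤ τ₀) :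
    M.gap A τ < M.gap A₀ (A + τ - A₀) := by
  rcases hne.lt_or_gt with h | h
  · obtain ⟨h1, h2, h3⟩ := hearly h
    -- On this doing line past doing is below A₀ and time remaining is at least τ₀, so the slope is
    -- below its nonpositive value at (A₀, τ₀) and the gap rises towards A₀. The other case mirrors
    -- this.
    have h4 : StrictMonoOn (fun x => M.gap x (A + τ - x)) (Icc A A₀) := by
      refine strictMonoOn_of_deriv_pos (convex_Icc _ _)
        (fun x _ => (hM.hasDerivAt_gap_doing _ x).continuousAt.continuousWithinAt) fun x hx => ?_
      rw [interior_Icc] at hx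
      rw [(hM.hasDerivAt_gap_doing _ x).deriv, neg_pos]
      refine mul_neg_of_pos_of_neg (hM.survival_pos x) (lt_of_lt_of_le ?_ h1)
      exact hM.slope_posterior_lt hR (hA.trans hx.1.le) hx.2 h3 (by linarith [hx.2])
    simpa using h4 ⟨le_rfl, h.le⟩ ⟨h.le, le_rfl⟩ h
  · obtain ⟨h1, h2⟩ := hlate h
    have h4 : StrictAntiOn (fun x => M.gap x (A + τ - x)) (Icc A₀ A) := by
      refine strictAntiOn_of_deriv_neg (convex_Icc _ _)
        (fun x _ => (hM.hasDerivAt_gap_doing _ x).continuousAt.continuousWithinAt) fun x hx => ?_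
      rw [interior_Icc] at hx
      rw [(hM.hasDerivAt_gap_doing _ x).deriv, neg_lt_zero]
      refine mul_pos (hM.survival_pos x) (lt_of_le_of_lt h1 ?_)
      exact hM.slope_posterior_lt hR hA₀ hx.1 (by linarith [hx.2]) (by linarith [hx.1])
    simpa using h4 ⟨le_rfl, h.le⟩ ⟨h.le, le_rfl⟩ h

end Standing

/-! ### The payoff of an effort path -/

/-- The fundamental theorem of calculus for locally Lipschitz functions. -/
theorem integral_eq_sub_of_locallyLipschitz {f f' : ℝ → ℝ} {a b : ℝ} (hf : LocallyLipschitz f)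
    (h : ∀ᵐ x, HasDerivAt f (f' x) x) : ∫ x in a..b, f' x = f b - f a := by
  obtain ⟨K, hK⟩ := (hf.locallyLipschitzOn (s := uIcc a b)).exists_lipschitzOnWith_of_compact
    isCompact_uIcc
  rw [← hK.absolutelyContinuousOnInterval.integral_deriv_eq_sub]
  refine intervalIntegral.integral_congr_ae ?_
  filter_upwards [h] with x hx _ using hx.deriv.symm

/-- Effort paths that are defined on the whole real line. -/
structure IsEffortPath (b : ℝ → ℝ) : Prop where
  aemeasurable : AEMeasurable b
  mem_Icc : ∀ τ, b τ ∈ Icc (0 : ℝ) 1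

theorem Admissible.isEffortPath_indicator {T : ℝ} {a : ℝ → ℝ} (ha : Admissible T a) :
    IsEffortPath ((Icc 0 T).indicator a) where
  aemeasurable := (aemeasurable_indicator_iff measurableSet_Icc).2 ha.1
  mem_Icc τ := by
    by_cases h : τ ∈ Icc 0 T
    · rw [indicator_of_mem h]; exact ha.2 τ h
    · rw [indicator_of_notMem h]; exact ⟨le_rfl, zero_le_one⟩

theorem pastDoing_congr {T : ℝ} {a b : ℝ → ℝ} (h : EqOn a b (Icc 0 T)) {τ : ℝ}
    (hτ : τ ∈ Icc 0 T) : pastDoing T a τ = pastDoing T b τ := by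
  refine intervalIntegral.integral_congr fun s hs => h ?_
  rw [uIcc_of_le hτ.2] at hs
  exact ⟨hτ.1.trans hs.1, hs.2⟩

variable (M) in
theorem payoff_congr {T : ℝ} (hT : 0 ≤ T) {a b : ℝ → ℝ} (h : EqOn a b (Icc 0 T)) :
    M.payoff T a = M.payoff T b := by
  refine intervalIntegral.integral_congr fun τ hτ => ?_
  rw [uIcc_of_le hT] at hτ
  simp only [pastDoing_congr h hτ, h hτ]

/-- The amount of past thinking. -/
def pastThinking (T : ℝ) (b : ℝ → ℝ) (τ : ℝ) : ℝ := T - τ - pastDoing T b τ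

theorem pastDoing_self (T : ℝ) (b : ℝ → ℝ) : pastDoing T b T = 0 :=
  intervalIntegral.integral_same

/-! ### Regularity of past doing and past thinking -/

namespace IsEffortPath

variable {b : ℝ → ℝ} (hb : IsEffortPath b)
include hb

theorem locallyIntegrable : LocallyIntegrable b := by
  refine (locallyIntegrable_const (1 : ℝ)).mono hb.aemeasurable.aestronglyMeasurable
    (ae_of_all _ fun τ => ?_)
  rw [Real.norm_of_nonneg (hb.mem_Icc τ).1, norm_one]
  exact (hb.mem_Icc τ).2

theorem intervalIntegrable (x y : ℝ) : IntervalIntegrable b volume x y :=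
  (hb.locallyIntegrable.integrableOn_isCompact isCompact_uIcc).intervalIntegrable

theorem pastDoing_sub (T τ τ' : ℝ) :
    pastDoing T b τ - pastDoing T b τ' = ∫ s in τ..τ', b s := by
  rw [sub_eq_iff_eq_add]
  exact (intervalIntegral.integral_add_adjacent_intervals (hb.intervalIntegrable _ _)
    (hb.intervalIntegrable _ _)).symm

theorem pastDoing_antitone (T : ℝ) : Antitone (pastDoing T b) := fun τ τ' h => by
  rw [← sub_nonneg, hb.pastDoing_sub]
  exact intervalIntegral.integral_nonneg h fun s _ => (hb.mem_Icc s).1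

theorem pastDoing_sub_le (T : ℝ) {τ τ' : ℝ} (h : τ ≤ τ') :
    pastDoing T b τ - pastDoing T b τ' ≤ τ' - τ := by
  rw [hb.pastDoing_sub]
  refine (intervalIntegral.integral_mono_on h (hb.intervalIntegrable _ _)
    (intervalIntegrable_const (c := (1 : ℝ))) fun s _ => (hb.mem_Icc s).2).trans (by simp)

theorem pastDoing_nonneg {T τ : ℝ} (h : τ ≤ T) : 0 ≤ pastDoing T b τ :=
  (pastDoing_self T b).symm.trans_le (hb.pastDoing_antitone T h)

theorem lipschitzWith_pastDoing (T : ℝ) : LipschitzWith 1 (pastDoing T b) :=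
  LipschitzWith.of_le_add fun τ τ' => by
    rw [Real.dist_eq]
    rcases le_total τ τ' with h | h
    · rw [abs_sub_comm, abs_of_nonneg (sub_nonneg.2 h)]
      linarith [hb.pastDoing_sub_le T h]
    · have := hb.pastDoing_antitone T h
      have := abs_nonneg (τ - τ')
      linarith

theorem continuous_pastDoing (T : ℝ) : Continuous (pastDoing T b) :=
  (hb.lipschitzWith_pastDoing T).continuous

theorem ae_hasDerivAt_pastDoing (T : ℝ) :
    ∀ᵐ τ, HasDerivAt (pastDoing T b) (-b τ) τ := by
  filter_upwards [_root_.LocallyIntegrable.ae_hasDerivAt_integral hb.locallyIntegrable] with τ h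
  refine (h T).neg.congr_of_eventuallyEq (Eventually.of_forall fun s => ?_)
  rw [pastDoing, intervalIntegral.integral_symm]; rfl

/-- The substitution of past thinking for time. -/
theorem integral_comp_pastThinking (T : ℝ) {f : ℝ → ℝ} (hf : Continuous f) :
    ∫ τ in (0 : ℝ)..T, f (pastThinking T b τ) * (1 - b τ)
      = ∫ θ in (0 : ℝ)..pastThinking T b 0, f θ := by
  have h1 : ∀ y, HasDerivAt (fun y => ∫ θ in (0 : ℝ)..y, f θ) (f y) y := fun y =>
    (hf.integral_hasStrictDerivAt 0 y).hasDerivAt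
  have h2 : ContDiff ℝ 1 fun y => ∫ θ in (0 : ℝ)..y, f θ := by
    rw [contDiff_one_iff_deriv]
    refine ⟨fun y => (h1 y).differentiableAt, ?_⟩
    rwa [funext fun y => (h1 y).deriv]
  -- Past thinking is merely Lipschitz, so the substitution is the almost-everywhere chain rule for
  -- an antiderivative of f.
  have h3 : LocallyLipschitz fun τ => ∫ θ in (0 : ℝ)..pastThinking T b τ, f θ :=
    h2.locallyLipschitz.comp ((contDiff_const.sub contDiff_id :
      ContDiff ℝ 1 fun τ : ℝ => T - τ).locallyLipschitz.sub
        (hb.lipschitzWith_pastDoing T).locallyLipschitz)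
  have h4 := integral_eq_sub_of_locallyLipschitz (a := 0) (b := T) h3
    (f' := fun τ => -(f (pastThinking T b τ) * (1 - b τ))) (by
      filter_upwards [hb.ae_hasDerivAt_pastDoing T] with τ hτ
      have h5 : HasDerivAt (pastThinking T b) (-1 - -b τ) τ :=
        ((hasDerivAt_id τ).const_sub T).sub hτ
      convert! (h1 (pastThinking T b τ)).comp τ h5 using 1
      ring)
  rw [intervalIntegral.integral_neg] at h4
  simp only [pastThinking, pastDoing_self, sub_self, intervalIntegral.integral_same] at h4 ⊢
  linarith

end IsEffortPath

variable (M) in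
/-- The expected payoff of doing until the deadline. -/
def payoffDoing (T : ℝ) : ℝ := M.pbar * M.U T - (1 - M.pbar) * M.c * T

/-- The function e^{-μθ}(p̄e^{-λA}U(τ) - (1 - p̄)cτ) is the weighted value of doing until the
deadline. It vanishes at τ = 0 and equals `payoffDoing` at τ = T. Its τ-derivative along the path is
the payoff integrand minus the term in `gap`, which vanishes where b = 1. -/
theorem Standing.payoff_eq (hM : M.Standing) {T : ℝ} (hT : 0 ≤ T) {b : ℝ → ℝ}
    (hb : IsEffortPath b) :
    M.payoff T b = M.payoffDoing T + ∫ τ in (0 : ℝ)..T,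
      Real.exp (-M.mu * pastThinking T b τ) * M.gap (pastDoing T b τ) τ * (1 - b τ) := by
  have hA := hb.continuous_pastDoing T
  have hθ : Continuous (pastThinking T b) := by unfold pastThinking; fun_prop
  have hE : Continuous fun τ => Real.exp (-M.mu * pastThinking T b τ) := by fun_prop
  have hV := hM.continuous_Vext
  have hS : Continuous fun τ => M.survival (pastDoing T b τ) := continuous_survival.comp hA
  have hP : Continuous fun τ => M.posterior M.pbar (pastDoing T b τ) :=
    hM.continuous_posterior.comp hA
  have hG : Continuous fun τ => M.gap (pastDoing T b τ) τ :=
    hM.continuous_gap.comp (hA.prodMk continuous_id)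
  have hpay : M.payoff T b = ∫ τ in (0 : ℝ)..T,
      Real.exp (-M.mu * pastThinking T b τ) * M.survival (pastDoing T b τ) *
        (M.mu * (1 - b τ) * M.Vext τ + M.lam * b τ * M.posterior M.pbar (pastDoing T b τ) * M.B
          - M.c) := by
    refine intervalIntegral.integral_congr fun τ hτ => ?_
    rw [uIcc_of_le hT] at hτ
    simp only [flow, hM.Vext_eq hτ.1, pastThinking, survival]
    ring
  have hi1 : IntervalIntegrable (fun τ =>
      Real.exp (-M.mu * pastThinking T b τ) * M.survival (pastDoing T b τ) *
        (M.mu * (1 - b τ) * M.Vext τ + M.lam * b τ * M.posterior M.pbar (pastDoing T b τ) * M.B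
          - M.c)) volume 0 T := by
    have h1 : Continuous fun τ => Real.exp (-M.mu * pastThinking T b τ) *
        M.survival (pastDoing T b τ) * (M.mu * M.Vext τ - M.c) := by fun_prop
    have h2 : Continuous fun τ => Real.exp (-M.mu * pastThinking T b τ) *
        M.survival (pastDoing T b τ) *
          (M.lam * M.posterior M.pbar (pastDoing T b τ) * M.B - M.mu * M.Vext τ) := by fun_prop
    convert! (h1.intervalIntegrable 0 T).add
      ((hb.intervalIntegrable 0 T).continuousOn_mul h2.continuousOn) using 1
    funext τ
    ring
  have hi2 : IntervalIntegrable (fun τ => Real.exp (-M.mu * pastThinking T b τ) *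
      M.gap (pastDoing T b τ) τ * (1 - b τ)) volume 0 T :=
    ((intervalIntegrable_const (c := (1 : ℝ))).sub (hb.intervalIntegrable 0 T)).continuousOn_mul
      (hE.mul hG).continuousOn
  have hl : LocallyLipschitz fun τ => Real.exp (-M.mu * pastThinking T b τ) *
      (M.pbar * Real.exp (-M.lam * pastDoing T b τ) * M.U τ - (1 - M.pbar) * M.c * τ) := by
    have h1 : ContDiff ℝ 1 fun z : ℝ × ℝ => Real.exp (-M.mu * (T - z.2 - z.1)) *
        (M.pbar * Real.exp (-M.lam * z.1) * M.U z.2 - (1 - M.pbar) * M.c * z.2) := by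
      unfold U; fun_prop
    have h2 := h1.locallyLipschitz.comp
      ((hb.lipschitzWith_pastDoing T).locallyLipschitz.prodMk LipschitzWith.id.locallyLipschitz)
    simpa only [Function.comp_def, pastThinking, id] using h2
  have hftc := integral_eq_sub_of_locallyLipschitz (a := 0) (b := T) hl
    (f' := fun τ => Real.exp (-M.mu * pastThinking T b τ) * M.survival (pastDoing T b τ) *
        (M.mu * (1 - b τ) * M.Vext τ + M.lam * b τ * M.posterior M.pbar (pastDoing T b τ) * M.B
          - M.c) -
      Real.exp (-M.mu * pastThinking T b τ) * M.gap (pastDoing T b τ) τ * (1 - b τ)) (by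
    filter_upwards [hb.ae_hasDerivAt_pastDoing T] with τ hτ
    have h1 : HasDerivAt (pastThinking T b) (-1 - -b τ) τ :=
      ((hasDerivAt_id τ).const_sub T).sub hτ
    have h2 : HasDerivAt M.U ((M.lam * M.B - M.c) * Real.exp (-M.lam * τ)) τ := by
      convert! ((hasDerivAt_exp_neg M.lam τ).const_sub 1).const_mul (M.B - M.c / M.lam) using 1
      have := hM.lam_pos.ne'
      field_simp
    have h3 := (h1.const_mul (-M.mu)).exp
    have h4 := (((hτ.const_mul (-M.lam)).exp.const_mul M.pbar).mul h2).sub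
      ((hasDerivAt_id τ).const_mul ((1 - M.pbar) * M.c))
    convert! h3.mul h4 using 1
    have h5 := hM.posterior_mul_survival (pastDoing T b τ)
    have h6 : Real.exp (-M.mu * pastThinking T b τ) * M.survival (pastDoing T b τ) *
        (M.mu * (1 - b τ) * M.Vext τ + M.lam * b τ * M.posterior M.pbar (pastDoing T b τ) * M.B
          - M.c) = Real.exp (-M.mu * pastThinking T b τ) * (M.survival (pastDoing T b τ) *
        (M.mu * (1 - b τ) * M.Vext τ - M.c) + M.lam * b τ * M.B *
          (M.pbar * Real.exp (-M.lam * pastDoing T b τ))) := by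
      rw [← h5]; ring
    rw [h6]
    simp only [gap, survival, denom, U, Pi.sub_apply, Pi.mul_apply, id]
    have := hM.lam_pos.ne'
    field_simp
    ring)
  rw [intervalIntegral.integral_sub hi1 hi2, ← hpay] at hftc
  simp only [pastThinking, pastDoing_self] at hftc ⊢
  simp only [payoffDoing]
  simp [U] at hftc ⊢
  linarith

/-! ### Doing, then thinking, then doing -/

variable (M) in
/-- The gain, over doing until the deadline, from doing for a time `α`, thinking for a time `Θ`, and
doing until the deadline. -/
def gain (T α Θ : ℝ) : ℝ :=
  ∫ θ in (0 : ℝ)..Θ, Real.exp (-M.mu * θ) * M.gap α (T - α - θ)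

namespace Standing

variable (hM : M.Standing)
include hM

theorem continuous_gain_integrand (T : ℝ) :
    Continuous fun z : ℝ × ℝ => Real.exp (-M.mu * z.2) * M.gap z.1 (T - z.1 - z.2) := by
  have := hM.continuous_gap.comp
    (by fun_prop : Continuous fun z : ℝ × ℝ => (z.1, T - z.1 - z.2))
  exact Continuous.mul (by fun_prop) this

theorem continuous_gain_integrand_right (T α : ℝ) :
    Continuous fun θ : ℝ => Real.exp (-M.mu * θ) * M.gap α (T - α - θ) :=
  (hM.continuous_gain_integrand T).comp (by fun_prop : Continuous fun θ : ℝ => (α, θ))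

theorem continuous_gain (T : ℝ) : Continuous fun z : ℝ × ℝ => M.gain T z.1 z.2 :=
  intervalIntegral.continuous_parametric_intervalIntegral_of_continuous
    (f := fun (z : ℝ × ℝ) θ => Real.exp (-M.mu * θ) * M.gap z.1 (T - z.1 - θ))
    ((hM.continuous_gain_integrand T).comp
      (by fun_prop : Continuous fun w : (ℝ × ℝ) × ℝ => (w.1.1, w.2))) continuous_snd

theorem gain_eq_integral {T : ℝ} {b : ℝ → ℝ} (hb : IsEffortPath b) (α : ℝ) :
    M.gain T α (pastThinking T b 0) = ∫ τ in (0 : ℝ)..T, Real.exp (-M.mu * pastThinking T b τ) *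
      M.gap α (T - α - pastThinking T b τ) * (1 - b τ) :=
  (hb.integral_comp_pastThinking T (hM.continuous_gain_integrand_right T α)).symm

/-- The slope is continuous along the path, so it has a zero unless an endpoint already serves; at
an endpoint one of the two conditions is vacuous. -/
theorem exists_crossing {T : ℝ} (hT : 0 ≤ T) {b : ℝ → ℝ} (hb : IsEffortPath b) :
    ∃ τ₀ ∈ Icc 0 T,
      (0 < τ₀ → 0 ≤ M.slope (M.posterior M.pbar (pastDoing T b τ₀)) τ₀) ∧
      (τ₀ < T → M.slope (M.posterior M.pbar (pastDoing T b τ₀)) τ₀ ≤ 0) := by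
  have hc : Continuous fun τ => M.slope (M.posterior M.pbar (pastDoing T b τ)) τ :=
    hM.continuous_slope.comp
      ((hM.continuous_posterior.comp (hb.continuous_pastDoing T)).prodMk continuous_id)
  by_cases h1 : 0 ≤ M.slope (M.posterior M.pbar (pastDoing T b T)) T
  · exact ⟨T, ⟨hT, le_rfl⟩, fun _ => h1, fun h => absurd h (lt_irrefl T)⟩
  by_cases h0 : M.slope (M.posterior M.pbar (pastDoing T b 0)) 0 ≤ 0
  · exact ⟨0, ⟨le_rfl, hT⟩, fun h => absurd h (lt_irrefl 0), fun _ => h0⟩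
  obtain ⟨τ₀, hτ₀, h⟩ := intermediate_value_Icc' hT hc.continuousOn
    (mem_Icc.2 ⟨(not_le.1 h1).le, (not_le.1 h0).le⟩)
  exact ⟨τ₀, hτ₀, fun _ => h.ge, fun _ => h.le⟩

/-- Every effort path is dominated by one that does, thinks, and does again. -/
theorem exists_payoff_le (hR : M.Regular) {T : ℝ} (hT : 0 ≤ T) {b : ℝ → ℝ}
    (hb : IsEffortPath b) :
    ∃ α ∈ Icc 0 (pastDoing T b 0),
      M.payoff T b ≤ M.payoffDoing T + M.gain T α (pastThinking T b 0) ∧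
      (M.payoffDoing T + M.gain T α (pastThinking T b 0) ≤ M.payoff T b →
        ∀ᵐ τ ∂volume.restrict (Ioc 0 T), b τ = 1 ∨ pastDoing T b τ = α) := by
  obtain ⟨τ₀, hτ₀, hpos, hneg⟩ := hM.exists_crossing hT hb
  have hA := hb.continuous_pastDoing T
  have hθ : Continuous (pastThinking T b) := by unfold pastThinking; fun_prop
  have hE : Continuous fun τ => Real.exp (-M.mu * pastThinking T b τ) := by fun_prop
  set α := pastDoing T b τ₀ with hα
  have hα0 : 0 ≤ α := hb.pastDoing_nonneg hτ₀.2
  have hlt : ∀ τ ∈ Icc 0 T, pastDoing T b τ ≠ α →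
      M.gap (pastDoing T b τ) τ < M.gap α (T - α - pastThinking T b τ) := by
    intro τ hτ hne
    -- The comparison point has past doing α and the same past thinking, so it lies on the doing
    -- line through the current state.
    have h1 : T - α - pastThinking T b τ = pastDoing T b τ + τ - α := by
      rw [pastThinking]; ring
    rw [h1]
    refine hM.gap_lt_of_crossing (τ₀ := τ₀) hR hα0 (hb.pastDoing_nonneg hτ.2) hτ.1 hne
      (fun h => ?_) (fun h => ?_)
    · have h2 : τ < τ₀ := lt_of_not_ge fun h' => (hb.pastDoing_antitone T h').not_gt h
      have := hb.pastDoing_sub_le T h2.le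
      exact ⟨hpos (hτ.1.trans_lt h2), by linarith⟩
    · have h2 : τ₀ < τ := lt_of_not_ge fun h' => (hb.pastDoing_antitone T h').not_gt h
      have := hb.pastDoing_sub_le T h2.le
      exact ⟨hneg (h2.trans_le hτ.2), by linarith, hτ₀.1⟩
  have hle : ∀ τ ∈ Icc 0 T,
      M.gap (pastDoing T b τ) τ ≤ M.gap α (T - α - pastThinking T b τ) := by
    intro τ hτ
    by_cases hne : pastDoing T b τ = α
    · have : T - α - pastThinking T b τ = τ := by rw [pastThinking, hne]; ring
      rw [this, hne]
    · exact (hlt τ hτ hne).le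
  have hint : ∀ f : ℝ → ℝ, Continuous f → IntervalIntegrable (fun τ =>
      Real.exp (-M.mu * pastThinking T b τ) * f τ * (1 - b τ)) volume 0 T := fun f hf =>
    ((intervalIntegrable_const (c := (1 : ℝ))).sub (hb.intervalIntegrable 0 T)).continuousOn_mul
      (hE.mul hf).continuousOn
  have hi1 := hint (fun τ => M.gap (pastDoing T b τ) τ)
    (hM.continuous_gap.comp (hA.prodMk continuous_id))
  have hi2 := hint (fun τ => M.gap α (T - α - pastThinking T b τ))
    (hM.continuous_gap.comp (continuous_const.prodMk (continuous_const.sub hθ)))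
  have hpt : ∀ τ ∈ Icc 0 T,
      Real.exp (-M.mu * pastThinking T b τ) * M.gap (pastDoing T b τ) τ * (1 - b τ) ≤
      Real.exp (-M.mu * pastThinking T b τ) * M.gap α (T - α - pastThinking T b τ) * (1 - b τ) :=
    fun τ hτ => mul_le_mul_of_nonneg_right
      (mul_le_mul_of_nonneg_left (hle τ hτ) (Real.exp_pos _).le) (sub_nonneg.2 (hb.mem_Icc τ).2)
  refine ⟨α, ⟨hα0, hb.pastDoing_antitone T hτ₀.1⟩, ?_, fun h => ?_⟩
  · rw [hM.payoff_eq hT hb, hM.gain_eq_integral hb]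
    exact add_le_add_right (intervalIntegral.integral_mono_on hT hi1 hi2 hpt) _
  · rw [hM.payoff_eq hT hb, hM.gain_eq_integral hb] at h
    have h1 := intervalIntegral.integral_mono_on hT hi1 hi2 hpt
    -- Equality of payoffs makes a nonnegative integrand vanish almost everywhere, whereas it is
    -- positive wherever b < 1 and past doing differs from α.
    have h2 := (intervalIntegral.integral_eq_zero_iff_of_le_of_nonneg_ae hT
      ((ae_restrict_iff' measurableSet_Ioc).2 (ae_of_all _ fun τ hτ =>
        sub_nonneg.2 (hpt τ (Ioc_subset_Icc_self hτ)))) (hi2.sub hi1)).1 (by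
          rw [intervalIntegral.integral_sub hi2 hi1]; linarith)
    filter_upwards [h2, ae_restrict_mem measurableSet_Ioc] with τ hτ hτm
    by_contra! hcon
    have h3 := hlt τ (Ioc_subset_Icc_self hτm) hcon.2
    have h4 : 0 < 1 - b τ := sub_pos.2 ((hb.mem_Icc τ).2.lt_of_ne hcon.1)
    have h5 := mul_lt_mul_of_pos_right
      (mul_lt_mul_of_pos_left h3 (Real.exp_pos (-M.mu * pastThinking T b τ))) h4
    simp only [Pi.zero_apply] at hτ
    linarith

end Standing

theorem isEffortPath_policy (Θ x : ℝ) : IsEffortPath (policy Θ x) where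
  aemeasurable := (Measurable.ite measurableSet_Iio measurable_const
    (Measurable.ite measurableSet_Iio measurable_const measurable_const)).aemeasurable
  mem_Icc τ := by unfold policy; split_ifs <;> simp

theorem admissible_policy (T Θ x : ℝ) : Admissible T (policy Θ x) :=
  ⟨(isEffortPath_policy Θ x).aemeasurable.restrict, fun τ _ => (isEffortPath_policy Θ x).mem_Icc τ⟩

/-- The amount of past doing during the thinking period of a policy. -/
theorem pastDoing_policy {T α Θ x τ : ℝ} (hα : 0 ≤ α) (hsum : α + Θ + x = T) (hτ : x ≤ τ)
    (hτ' : τ ≤ x + Θ) : pastDoing T (policy Θ x) τ = α := by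
  have hi := (isEffortPath_policy Θ x).intervalIntegrable
  rw [pastDoing, ← intervalIntegral.integral_add_adjacent_intervals (hi τ (x + Θ)) (hi (x + Θ) T)]
  have h1 : ∫ s in τ..(x + Θ), policy Θ x s = ∫ s in τ..(x + Θ), (0 : ℝ) :=
    intervalIntegral.integral_congr_Ioo_of_le hτ' fun s hs => by
      simp [policy, not_lt.2 (hτ.trans hs.1.le), hs.2]
  have h2 : ∫ s in (x + Θ)..T, policy Θ x s = ∫ s in (x + Θ)..T, (1 : ℝ) :=
    intervalIntegral.integral_congr_Ioo_of_le (by linarith) fun s hs => by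
      simp [policy, not_lt.2 hs.1.le]
  rw [h1, h2]
  simp
  linarith

theorem pastDoing_policy_zero {T α Θ x : ℝ} (hα : 0 ≤ α) (hΘ : 0 ≤ Θ) (hx : 0 ≤ x)
    (hsum : α + Θ + x = T) : pastDoing T (policy Θ x) 0 = α + x := by
  have hb := isEffortPath_policy Θ x
  have h1 := hb.pastDoing_sub T 0 x
  have h2 : ∫ s in (0 : ℝ)..x, policy Θ x s = ∫ s in (0 : ℝ)..x, (1 : ℝ) :=
    intervalIntegral.integral_congr_Ioo_of_le hx fun s hs => by simp [policy, hs.2]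
  rw [pastDoing_policy hα hsum le_rfl (by linarith), h2] at h1
  simp at h1
  linarith

theorem Standing.payoff_policy (hM : M.Standing) {T α Θ x : ℝ} (hα : 0 ≤ α) (hΘ : 0 ≤ Θ)
    (hx : 0 ≤ x) (hsum : α + Θ + x = T) :
    M.payoff T (policy Θ x) = M.payoffDoing T + M.gain T α Θ := by
  have hT : 0 ≤ T := by linarith
  have hb := isEffortPath_policy Θ x
  have h1 : pastThinking T (policy Θ x) 0 = Θ := by
    rw [pastThinking, pastDoing_policy_zero hα hΘ hx hsum]; linarith
  have h2 := hM.gain_eq_integral (T := T) hb α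
  rw [h1] at h2
  rw [hM.payoff_eq hT hb, h2]
  congr 1
  refine intervalIntegral.integral_congr fun τ _ => ?_
  by_cases hτ : x ≤ τ ∧ τ < x + Θ
  · have h3 := pastDoing_policy hα hsum hτ.1 hτ.2.le
    have h4 : T - α - pastThinking T (policy Θ x) τ = τ := by rw [pastThinking, h3]; ring
    simp only [h3, h4]
  · have h3 : policy Θ x τ = 1 := by
      unfold policy
      split_ifs with h4 h5
      · rfl
      · exact absurd ⟨not_lt.1 h4, h5⟩ hτ
      · rfl
    simp [h3]

/-- A path that thinks only at past doing `α` does, thinks, and does again. -/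
theorem IsEffortPath.ae_eq_policy {b : ℝ → ℝ} (hb : IsEffortPath b) {T α : ℝ} (hT : 0 ≤ T)
    (hα : α ∈ Icc 0 (pastDoing T b 0))
    (h : ∀ᵐ τ ∂volume.restrict (Ioc 0 T), b τ = 1 ∨ pastDoing T b τ = α) :
    b =ᵐ[volume.restrict (Icc 0 T)] policy (pastThinking T b 0) (pastDoing T b 0 - α) := by
  rw [ae_restrict_iff' measurableSet_Ioc] at h
  have hAT := pastDoing_self T b
  have hA0 := hb.pastDoing_sub_le T hT
  set x := pastDoing T b 0 - α with hx
  have hx0 : 0 ≤ x := sub_nonneg.2 hα.2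
  have hxT : x ≤ T - α := by linarith
  have hend : x + pastThinking T b 0 = T - α := by rw [pastThinking]; linarith
  -- Past doing changes at rate at most one, so it cannot equal α when fewer than x units of time
  -- remain, nor before time α has elapsed.
  have hlate : ∀ᵐ τ, τ ∈ Ioc 0 T → τ < x → b τ = 1 := by
    filter_upwards [h] with τ hτ hm hlt
    refine (hτ hm).resolve_right fun h1 => ?_
    have := hb.pastDoing_sub_le T hm.1.le
    linarith
  have hearly : ∀ᵐ τ, τ ∈ Ioc 0 T → T - α < τ → b τ = 1 := by
    filter_upwards [h] with τ hτ hm hlt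
    refine (hτ hm).resolve_right fun h1 => ?_
    have := hb.pastDoing_sub_le T hm.2
    linarith
  have hne : ∀ y : ℝ, ∀ᵐ τ : ℝ, τ ≠ y := fun y => by simp [ae_iff, measure_singleton]
  have h1 : pastDoing T b (T - α) = α := by
    have h2 : ∫ s in (T - α)..T, b s = ∫ s in (T - α)..T, (1 : ℝ) := by
      refine intervalIntegral.integral_congr_ae ?_
      filter_upwards [hearly] with τ hτ hm
      rw [uIoc_of_le (by linarith [hα.1])] at hm
      exact hτ ⟨by linarith [hm.1], hm.2⟩ hm.1
    rw [pastDoing, h2]; simp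
  have h2 : pastDoing T b x = α := by
    have h3 : ∫ s in (0 : ℝ)..x, b s = ∫ s in (0 : ℝ)..x, (1 : ℝ) := by
      refine intervalIntegral.integral_congr_ae ?_
      filter_upwards [hlate, hne x] with τ hτ hτx hm
      rw [uIoc_of_le hx0] at hm
      exact hτ ⟨hm.1, by linarith [hm.2, hα.1]⟩ (hm.2.lt_of_ne hτx)
    have h4 := hb.pastDoing_sub T 0 x
    rw [h3] at h4
    simp at h4
    linarith
  -- Past doing is α at both ends of the middle interval, so the nonnegative b vanishes almost
  -- everywhere on it.
  have h3 := hb.pastDoing_sub T x (T - α)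
  rw [h1, h2, sub_self] at h3
  have h4 := (intervalIntegral.integral_eq_zero_iff_of_le_of_nonneg_ae hxT
    (ae_of_all _ fun τ => (hb.mem_Icc τ).1) (hb.intervalIntegrable x (T - α))).1 h3.symm
  rw [EventuallyEq, ae_restrict_iff' measurableSet_Ioc] at h4
  rw [EventuallyEq, ae_restrict_iff' measurableSet_Icc]
  filter_upwards [hlate, hearly, h4, hne 0, hne x, hne (T - α)] with τ k1 k2 k3 k4 k5 k6 hm
  have hm' : τ ∈ Ioc 0 T := ⟨hm.1.lt_of_ne k4.symm, hm.2⟩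
  rw [policy, hend]
  split_ifs with c1 c2
  · exact k1 hm' c1
  · exact k3 ⟨(not_lt.1 c1).lt_of_ne k5.symm, c2.le⟩
  · exact k2 hm' ((not_lt.1 c2).lt_of_ne k6.symm)

/-! ### First-order conditions -/

theorem nonpos_of_hasDerivAt_of_right {f : ℝ → ℝ} {f' a : ℝ} (h : HasDerivAt f f' a)
    (hmax : ∀ᶠ y in 𝓝[>] a, f y ≤ f a) : f' ≤ 0 := by
  have h1 := (hasDerivWithinAt_iff_tendsto_slope' (s := Ioi a) (by simp)).1 h.hasDerivWithinAt
  refine le_of_tendsto h1 ?_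
  filter_upwards [hmax, self_mem_nhdsWithin] with y hy hay
  rw [slope_def_field]
  exact div_nonpos_of_nonpos_of_nonneg (sub_nonpos.2 hy) (sub_nonneg.2 (le_of_lt hay))

theorem nonneg_of_hasDerivAt_of_left {f : ℝ → ℝ} {f' a : ℝ} (h : HasDerivAt f f' a)
    (hmax : ∀ᶠ y in 𝓝[<] a, f y ≤ f a) : 0 ≤ f' := by
  have h1 := (hasDerivWithinAt_iff_tendsto_slope' (s := Iio a) (by simp)).1 h.hasDerivWithinAt
  refine ge_of_tendsto h1 ?_
  filter_upwards [hmax, self_mem_nhdsWithin] with y hy hay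
  rw [slope_def_field]
  exact div_nonneg_of_nonpos (sub_nonpos.2 hy) (sub_nonpos.2 (le_of_lt hay))

/-- Differentiation of a parametric integral with a jointly continuous derivative. -/
theorem hasDerivAt_integral_of_continuous {f f' : ℝ → ℝ → ℝ} (hf : ∀ x, Continuous (f x))
    (hf' : Continuous fun z : ℝ × ℝ => f' z.1 z.2)
    (h : ∀ x t, HasDerivAt (fun x => f x t) (f' x t) x) (a b x₀ : ℝ) :
    HasDerivAt (fun x => ∫ t in a..b, f x t) (∫ t in a..b, f' x₀ t) x₀ := by
  obtain ⟨C, hC⟩ := ((isCompact_closedBall x₀ 1).prod (isCompact_uIcc (a := a) (b := b)))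
    |>.exists_bound_of_continuousOn hf'.continuousOn
  have hx : Continuous (f' x₀) := hf'.comp (by fun_prop : Continuous fun t : ℝ => (x₀, t))
  refine (intervalIntegral.hasDerivAt_integral_of_dominated_loc_of_deriv_le (bound := fun _ => C)
    (Metric.closedBall_mem_nhds x₀ one_pos)
    (Eventually.of_forall fun x => (hf x).aestronglyMeasurable)
    ((hf x₀).intervalIntegrable a b) hx.aestronglyMeasurable
    (ae_of_all _ fun t ht x hx => hC (x, t) ⟨hx, uIoc_subset_uIcc ht⟩)
    intervalIntegrable_const (ae_of_all _ fun t _ x _ => h x t)).2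

theorem yhat_zero (p ξ : ℝ) : M.yhat 0 p ξ = 0 := intervalIntegral.integral_same

namespace Standing

variable (hM : M.Standing)
include hM

theorem yhat_eq {Θ ξ : ℝ} (p : ℝ) (hΘ : 0 ≤ Θ) (hξ : 0 ≤ ξ) :
    M.yhat Θ p ξ = ∫ s in (0 : ℝ)..Θ, Real.exp (M.mu * s) * M.slope p (ξ + s) := by
  refine intervalIntegral.integral_congr fun s hs => ?_
  rw [uIcc_of_le hΘ] at hs
  simp only [hM.ydot_eq p (add_nonneg hξ hs.1)]

theorem hasDerivAt_gain_right (T α Θ : ℝ) :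
    HasDerivAt (M.gain T α) (Real.exp (-M.mu * Θ) * M.gap α (T - α - Θ)) Θ :=
  ((hM.continuous_gain_integrand_right T α).integral_hasStrictDerivAt 0 Θ).hasDerivAt

/-- Raising α moves every unit of thinking along its doing line, so the integrand changes by the
slope; reversing the thinking period, s = Θ - θ, turns the integral into ŷ. -/
theorem hasDerivAt_gain_left {T α Θ : ℝ} (hΘ : 0 ≤ Θ) (hx : 0 ≤ T - α - Θ) :
    HasDerivAt (fun α => M.gain T α Θ) (-(M.survival α * Real.exp (-M.mu * Θ) *
      M.yhat Θ (M.posterior M.pbar α) (T - α - Θ))) α := by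
  have hs : Continuous fun z : ℝ × ℝ => M.slope (M.posterior M.pbar z.1) (T - z.2 - z.1) :=
    hM.continuous_slope.comp ((hM.continuous_posterior.comp continuous_fst).prodMk (by fun_prop))
  have hS : Continuous fun z : ℝ × ℝ => M.survival z.1 := continuous_survival.comp continuous_fst
  have hf' : Continuous fun z : ℝ × ℝ => Real.exp (-M.mu * z.2) *
      -(M.survival z.1 * M.slope (M.posterior M.pbar z.1) (T - z.2 - z.1)) := by fun_prop
  have h := hasDerivAt_integral_of_continuous
    (f := fun α θ => Real.exp (-M.mu * θ) * M.gap α (T - α - θ))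
    (f' := fun α θ => Real.exp (-M.mu * θ) *
      -(M.survival α * M.slope (M.posterior M.pbar α) (T - θ - α)))
    (hM.continuous_gain_integrand_right T) hf' (fun x t => by
      have h1 := (hM.hasDerivAt_gap_doing (T - t) x).const_mul (Real.exp (-M.mu * t))
      simpa only [sub_right_comm T t] using h1) 0 Θ α
  convert! h using 1
  rw [hM.yhat_eq _ hΘ hx]
  have h2 := intervalIntegral.integral_comp_sub_left (a := 0) (b := Θ) (fun s =>
    Real.exp (M.mu * s) * M.slope (M.posterior M.pbar α) (T - α - Θ + s)) Θ
  rw [sub_self, sub_zero] at h2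
  rw [← h2, ← intervalIntegral.integral_const_mul, ← intervalIntegral.integral_neg]
  refine intervalIntegral.integral_congr fun θ _ => ?_
  have h3 : Real.exp (-M.mu * Θ) * Real.exp (M.mu * (Θ - θ)) = Real.exp (-M.mu * θ) := by
    rw [← Real.exp_add]; ring_nf
  have h4 : T - α - Θ + (Θ - θ) = T - θ - α := by ring
  simp only [h4, ← h3]
  ring

end Standing

variable (M) in
/-- The gain is maximal at `(α, Θ)`. -/
def IsMaxGain (T α Θ : ℝ) : Prop :=
  0 ≤ α ∧ 0 ≤ Θ ∧ α + Θ ≤ T ∧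
    ∀ α' Θ', 0 ≤ α' → 0 ≤ Θ' → α' + Θ' ≤ T → M.gain T α' Θ' ≤ M.gain T α Θ

namespace Standing

variable (hM : M.Standing)
include hM

theorem exists_isMaxGain {T : ℝ} (hT : 0 ≤ T) : ∃ α Θ, M.IsMaxGain T α Θ := by
  have hc : IsCompact ({z | z.1 + z.2 ≤ T} ∩ Icc (0 : ℝ) T ×ˢ Icc (0 : ℝ) T) :=
    (isCompact_Icc.prod isCompact_Icc).inter_left
      (isClosed_le (by fun_prop) continuous_const)
  obtain ⟨z, ⟨hz1, hz2, hz3⟩, hmax⟩ := hc.exists_isMaxOn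
    ⟨(0, 0), by simpa using hT, ⟨le_rfl, hT⟩, ⟨le_rfl, hT⟩⟩ (hM.continuous_gain T).continuousOn
  refine ⟨z.1, z.2, hz2.1, hz3.1, hz1, fun α' Θ' h1 h2 h3 => ?_⟩
  exact hmax (show (α', Θ') ∈ _ from ⟨h3, ⟨h1, by linarith⟩, ⟨h2, by linarith⟩⟩)

/-- With Θ = 0 the gain is zero whatever α is, so every (r, 0) is a maximizer and the right
derivative in Θ there is at most zero. -/
theorem gap_nonpos_of_isMaxGain {T α : ℝ} (h : M.IsMaxGain T α 0) {r : ℝ} (hr : r ∈ Icc 0 T) :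
    M.gap r (T - r) ≤ 0 := by
  rcases hr.2.eq_or_lt with h1 | h1
  · rw [h1, sub_self]; exact (hM.gap_zero_neg T).le
  have h2 := nonpos_of_hasDerivAt_of_right (hM.hasDerivAt_gain_right T r 0) (by
    filter_upwards [Ioo_mem_nhdsGT (sub_pos.2 h1)] with Θ hΘ
    refine (h.2.2.2 r Θ hr.1 hΘ.1.le (by linarith [hΘ.2])).trans_eq ?_
    simp [gain])
  simpa using h2

/-- Shortening the thinking period gives `gap` ≥ 0, which rules out an empty final period; then
lengthening is feasible too and gives `gap` ≤ 0. -/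
theorem pos_and_gap_eq_zero_of_isMaxGain {T α Θ : ℝ} (h : M.IsMaxGain T α Θ) (hΘ : 0 < Θ) :
    0 < T - α - Θ ∧ M.gap α (T - α - Θ) = 0 := by
  obtain ⟨hα, -, hsum, hmax⟩ := h
  have hd := hM.hasDerivAt_gain_right T α Θ
  have h1 := nonneg_of_hasDerivAt_of_left hd (by
    filter_upwards [Ioo_mem_nhdsLT hΘ] with Θ' hΘ'
    exact hmax α Θ' hα hΘ'.1.le (by linarith [hΘ'.2]))
  have h2 : 0 ≤ M.gap α (T - α - Θ) := nonneg_of_mul_nonneg_right h1 (Real.exp_pos _)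
  have h3 : 0 < T - α - Θ := by
    refine lt_of_le_of_ne (by linarith) fun h3 => ?_
    rw [← h3] at h2
    exact (hM.gap_zero_neg α).not_ge h2
  refine ⟨h3, le_antisymm ?_ h2⟩
  have h4 := nonpos_of_hasDerivAt_of_right hd (by
    filter_upwards [Ioo_mem_nhdsGT (by linarith : Θ < T - α)] with Θ' hΘ'
    exact hmax α Θ' hα (hΘ.trans hΘ'.1).le (by linarith [hΘ'.2]))
  exact nonpos_of_mul_nonpos_right h4 (Real.exp_pos _)

theorem yhat_nonneg_of_isMaxGain {T α Θ : ℝ} (h : M.IsMaxGain T α Θ) (hΘ : 0 < Θ) :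
    0 ≤ M.yhat Θ (M.posterior M.pbar α) (T - α - Θ) := by
  have hx := (hM.pos_and_gap_eq_zero_of_isMaxGain h hΘ).1
  have h1 := nonpos_of_hasDerivAt_of_right (hM.hasDerivAt_gain_left hΘ.le hx.le) (by
    filter_upwards [Ioo_mem_nhdsGT (by linarith : α < T - Θ)] with α' hα'
    exact h.2.2.2 α' Θ (h.1.trans hα'.1.le) hΘ.le (by linarith [hα'.2]))
  exact nonneg_of_mul_nonneg_right (neg_nonpos.1 h1)
    (mul_pos (hM.survival_pos α) (Real.exp_pos _))

theorem yhat_eq_zero_of_isMaxGain {T α Θ : ℝ} (h : M.IsMaxGain T α Θ) (hα : 0 < α) (hΘ : 0 < Θ) :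
    M.yhat Θ (M.posterior M.pbar α) (T - α - Θ) = 0 := by
  have hx := (hM.pos_and_gap_eq_zero_of_isMaxGain h hΘ).1
  refine le_antisymm ?_ (hM.yhat_nonneg_of_isMaxGain h hΘ)
  have h1 := nonneg_of_hasDerivAt_of_left (hM.hasDerivAt_gain_left hΘ.le hx.le) (by
    filter_upwards [Ioo_mem_nhdsLT hα] with α' hα'
    exact h.2.2.2 α' Θ hα'.1.le hΘ.le (by linarith [hα'.2]))
  exact nonpos_of_mul_nonpos_right (neg_nonneg.1 h1)
    (mul_pos (hM.survival_pos α) (Real.exp_pos _))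

/-! ### The relative preference for thinking -/

theorem continuous_yhat_integrand (p ξ : ℝ) :
    Continuous fun s => Real.exp (M.mu * s) * M.slope p (ξ + s) := by
  have := hM.continuous_slope_right p
  fun_prop

theorem yhat_sub {p ξ s Θ : ℝ} (hξ : 0 ≤ ξ) (hs : 0 ≤ s) (hsΘ : s ≤ Θ) :
    M.yhat Θ p ξ - M.yhat s p ξ
      = ∫ r in s..Θ, Real.exp (M.mu * r) * M.slope p (ξ + r) := by
  have hi := (hM.continuous_yhat_integrand p ξ).intervalIntegrable (μ := volume)
  rw [hM.yhat_eq p (hs.trans hsΘ) hξ, hM.yhat_eq p hs hξ, sub_eq_iff_eq_add',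
    intervalIntegral.integral_add_adjacent_intervals (hi 0 s) (hi s Θ)]

theorem yhat_lt {p ξ s Θ : ℝ} (hp : p ≤ M.pbar) (hξ : 0 ≤ ξ) (hs : 0 ≤ s) (hsΘ : s < Θ)
    (h : M.slope p (ξ + s) < 0) : M.yhat Θ p ξ < M.yhat s p ξ := by
  rw [← sub_neg, hM.yhat_sub hξ hs hsΘ.le, ← neg_pos, ← intervalIntegral.integral_neg]
  refine intervalIntegral.intervalIntegral_pos_of_pos_on
    ((hM.continuous_yhat_integrand p ξ).neg.intervalIntegrable _ _) (fun r hr => ?_) hsΘ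
  rw [neg_pos]
  refine mul_neg_of_pos_of_neg (Real.exp_pos _) (lt_of_le_of_lt ?_ h)
  exact hM.slope_antitoneOn hp (mem_Ici.2 (by linarith)) (mem_Ici.2 (by linarith [hr.1]))
    (by linarith [hr.1])

theorem yhat_le {p ξ s Θ : ℝ} (hp : p ≤ M.pbar) (hξ : 0 ≤ ξ) (hs : 0 ≤ s) (hsΘ : s ≤ Θ)
    (h : 0 ≤ M.slope p (ξ + Θ)) : M.yhat s p ξ ≤ M.yhat Θ p ξ := by
  rw [← sub_nonneg, hM.yhat_sub hξ hs hsΘ]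
  refine intervalIntegral.integral_nonneg hsΘ fun r hr => mul_nonneg (Real.exp_pos _).le ?_
  exact h.trans (hM.slope_antitoneOn hp (mem_Ici.2 (by linarith [hr.1]))
    (mem_Ici.2 (by linarith [hr.1])) (by linarith [hr.2]))

/-- ŷ starts at zero with a decreasing slope, so once it starts downwards it stays negative. -/
theorem slope_nonneg_of_yhat_nonneg {p ξ Θ : ℝ} (hp : p ≤ M.pbar) (hξ : 0 ≤ ξ) (hΘ : 0 < Θ)
    (h : 0 ≤ M.yhat Θ p ξ) : 0 ≤ M.slope p ξ := by
  by_contra! hneg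
  have := hM.yhat_lt hp hξ le_rfl hΘ (by rwa [add_zero])
  rw [yhat_zero] at this
  linarith

/-- As its slope changes sign at most once, ŷ rises from zero and then falls. -/
theorem yhat_nonneg_of_le {p ξ s Θ : ℝ} (hp : p ≤ M.pbar) (hξ : 0 ≤ ξ) (hs : 0 ≤ s)
    (hsΘ : s ≤ Θ) (h : 0 ≤ M.yhat Θ p ξ) : 0 ≤ M.yhat s p ξ := by
  rcases hsΘ.eq_or_lt with rfl | hlt
  · exact h
  by_cases hsl : 0 ≤ M.slope p (ξ + s)
  · have := hM.yhat_le hp hξ le_rfl hs hsl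
    rwa [yhat_zero] at this
  · exact h.trans (hM.yhat_lt hp hξ hs hlt (not_le.1 hsl)).le

/-- If the slope is strictly decreasing, then the relative preference vanishes only once. -/
theorem yhat_pos_of_lt {p ξ s Θ : ℝ} (hp : p < M.pbar) (hξ : 0 ≤ ξ) (hs : 0 < s) (hsΘ : s < Θ)
    (h : 0 ≤ M.yhat Θ p ξ) : 0 < M.yhat s p ξ := by
  by_cases hsl : 0 ≤ M.slope p (ξ + s)
  · rw [hM.yhat_eq p hs.le hξ]
    refine intervalIntegral.intervalIntegral_pos_of_pos_on
      ((hM.continuous_yhat_integrand p ξ).intervalIntegrable _ _) (fun r hr => ?_) hs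
    refine mul_pos (Real.exp_pos _) (hsl.trans_lt ?_)
    exact hM.slope_strictAntiOn hp (mem_Ici.2 (by linarith [hr.1])) (mem_Ici.2 (by linarith))
      (by linarith [hr.2])
  · exact h.trans_lt (hM.yhat_lt hp.le hξ hs.le hsΘ (not_le.1 hsl))

/-- There are no two stationary policies with final doing periods of different lengths. -/
theorem stationary_unique (hR : M.Regular) {A A' Θ Θ' x x' : ℝ} (hA' : 0 ≤ A')
    (hΘ : 0 < Θ) (hΘ' : 0 < Θ') (hx : 0 ≤ x) (hxx : x < x')
    (hsum : A + Θ + x = A' + Θ' + x') (hg : M.gap A x = 0) (hg' : M.gap A' x' = 0)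
    (hy : M.yhat Θ (M.posterior M.pbar A) x = 0)
    (hy' : 0 ≤ M.yhat Θ' (M.posterior M.pbar A') x') : False := by
  have hx' : 0 ≤ x' := hx.trans hxx.le
  have hs' := hM.slope_nonneg_of_yhat_nonneg (hM.posterior_le hA') hx' hΘ' hy'
  -- Otherwise the belief after A' is at most `q x`, so thinking is weakly preferred at x and hence
  -- strictly preferred at x', against `hg'`.
  have hAA : A' < A := by
    by_contra! hle
    have h1 : M.q x = M.posterior M.pbar A := (hM.gap_eq_zero_iff hx).1 hg
    have h2 : 0 ≤ M.gap A' x := by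
      by_contra! h3
      have h4 := (hM.gap_nonpos_iff hx).1 h3.le
      have h5 := hM.posterior_strictAnti.antitone hle
      exact h3.ne ((hM.gap_eq_zero_iff hx).2 (h1.trans (le_antisymm (h1 ▸ h4) h5)))
    exact (hM.gap_thinking_pos hA' hx hxx hs' h2).ne' hg'
  have hp : M.posterior M.pbar A < M.pbar := hM.posterior_lt (hA'.trans_lt hAA)
  have hpp : ∀ τ, 0 ≤ τ →
      M.slope (M.posterior M.pbar A') τ < M.slope (M.posterior M.pbar A) τ := fun τ hτ =>
    hM.slope_strictAnti_left hR hτ (hM.posterior_strictAnti hAA)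
  set p := M.posterior M.pbar A with hpdef
  set p' := M.posterior M.pbar A' with hpdef'
  have hanti := hM.slope_strictAntiOn hp
  have hend : M.slope p (x + Θ) < 0 := by
    by_contra! hsl
    have h1 := hM.yhat_pos_of_lt (s := Θ / 2) hp hx (by linarith) (by linarith) hy.ge
    have h2 := hM.yhat_le hp.le hx (by linarith : 0 ≤ Θ / 2) (by linarith) hsl
    linarith
  -- The two thinking periods overlap: the slope at belief p is positive at x' and negative at x +
  -- Θ.
  have hlen : x' < x + Θ := by
    by_contra! hle
    have h1 := hanti.antitoneOn (mem_Ici.2 (by linarith : 0 ≤ x + Θ)) (mem_Ici.2 hx') hle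
    have h2 := hpp x' hx'
    linarith
  set d := x' - x with hd
  set r := x + Θ - x' with hr
  have hrΘ : r < Θ' := by linarith
  have hy1 : 0 < M.yhat d p x := hM.yhat_pos_of_lt hp hx (by linarith) (by linarith) hy.ge
  have hy2 := hM.yhat_sub (p := p) hx (by linarith : 0 ≤ d) (by linarith : d ≤ Θ)
  have hy3 : ∫ s in d..Θ, Real.exp (M.mu * s) * M.slope p (x + s)
      = Real.exp (M.mu * d) * M.yhat r p x' := by
    have h1 := intervalIntegral.integral_comp_add_right (a := 0) (b := r)
      (fun s => Real.exp (M.mu * s) * M.slope p (x + s)) d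
    rw [zero_add, (by rw [hr, hd]; ring : r + d = Θ)] at h1
    rw [← h1, hM.yhat_eq p (by linarith) hx', ← intervalIntegral.integral_const_mul]
    refine intervalIntegral.integral_congr fun s _ => ?_
    have h2 : Real.exp (M.mu * (s + d)) = Real.exp (M.mu * d) * Real.exp (M.mu * s) := by
      rw [← Real.exp_add]; ring_nf
    have h3 : x + (s + d) = x' + s := by rw [hd]; ring
    simp only [h2, h3, mul_assoc]
  -- The part of the first integral up to x' is positive and the total is zero, so the part over the
  -- overlap is negative.
  have hy4 : M.yhat r p x' < 0 := by
    have : Real.exp (M.mu * d) * M.yhat r p x' < 0 := by linarith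
    exact neg_of_mul_neg_right this (Real.exp_pos _).le
  have hy5 : M.yhat r p' x' ≤ M.yhat r p x' := by
    rw [hM.yhat_eq p' (by linarith) hx', hM.yhat_eq p (by linarith) hx']
    refine intervalIntegral.integral_mono_on (by linarith)
      ((hM.continuous_yhat_integrand _ _).intervalIntegrable _ _)
      ((hM.continuous_yhat_integrand _ _).intervalIntegrable _ _) fun s hs => ?_
    exact mul_le_mul_of_nonneg_left (hpp _ (by linarith [hs.1])).le (Real.exp_pos _).le
  -- Since A' < A, the second thinking period extends beyond x + Θ, where the slope at the higher
  -- belief p' is negative as well; so ŷ falls further below zero, against `hy'`.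
  have hy6 := hM.yhat_lt (hM.posterior_le hA') hx' (by linarith : 0 ≤ r) hrΘ (by
    rw [(by rw [hr]; ring : x' + r = x + Θ)]
    exact (hpp _ (by linarith)).trans hend)
  linarith

end Standing

/-! ### The algorithm -/

theorem len₂_eq_of_isLeast {x τ : ℝ} (h : IsLeast (M.roots x) τ) : M.len₂ x = τ := by
  have h1 : ∃ τ, IsLeast (M.roots x) τ := ⟨τ, h⟩
  rw [len₂, dif_pos h1, (Classical.choose_spec h1).unique h]

theorem len₂_eq_top_or (M : Model) (x : ℝ) :
    M.len₂ x = ⊤ ∨ ∃ τ, IsLeast (M.roots x) τ ∧ M.len₂ x = τ := by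
  by_cases h : ∃ τ, IsLeast (M.roots x) τ
  · obtain ⟨τ, hτ⟩ := h
    exact Or.inr ⟨τ, hτ, len₂_eq_of_isLeast hτ⟩
  · exact Or.inl (dif_neg h)

theorem mem_fixedPoints_iff {T x : ℝ} :
    x ∈ M.fixedPoints T ↔ 0 < x ∧ ∃ τ, IsLeast (M.roots x) τ ∧ M.len₁ x + τ + x = T := by
  refine and_congr_right fun _ => ⟨fun h => ?_, ?_⟩
  · rcases M.len₂_eq_top_or x with h1 | ⟨τ, hτ, h1⟩
    · rw [h1, EReal.coe_add_top, EReal.top_add_coe] at h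
      exact absurd h (EReal.coe_ne_top T).symm
    · rw [h1] at h
      exact ⟨τ, hτ, by exact_mod_cast h⟩
  · rintro ⟨τ, hτ, h⟩
    rw [len₂_eq_of_isLeast hτ]
    exact_mod_cast h

/-- The algorithm returns at most one triple. -/
theorem Returns.unique {T τ₁ τ₂ τ₃ σ₁ σ₂ σ₃ : ℝ} (h : M.Returns T τ₁ τ₂ τ₃)
    (h' : M.Returns T σ₁ σ₂ σ₃) : τ₁ = σ₁ ∧ τ₂ = σ₂ ∧ τ₃ = σ₃ := by
  obtain ⟨m, hm, h⟩ := h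
  obtain ⟨m', hm', h'⟩ := h'
  obtain rfl := hm.unique hm'
  rcases h with ⟨h, rfl, rfl, rfl⟩ | ⟨h, ht, rfl, rfl, rfl⟩ | ⟨h, ht, m₁, hm₁, hτ, rfl, h2⟩ <;>
  rcases h' with ⟨k, rfl, rfl, rfl⟩ | ⟨k, kt, rfl, rfl, rfl⟩ | ⟨k, kt, m₁', hm₁', hσ, rfl, k2⟩
  · exact ⟨rfl, rfl, rfl⟩
  · exact absurd h k.not_ge
  · exact absurd h k.not_ge
  · exact absurd k h.not_ge
  · exact ⟨rfl, rfl, rfl⟩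
  · exact absurd ht kt
  · exact absurd k h.not_ge
  · exact absurd kt ht
  · obtain rfl := hm₁.unique hm₁'
    obtain rfl := hτ.unique hσ
    exact ⟨rfl, EReal.coe_injective (h2.trans k2.symm), rfl⟩

theorem policy_zero (x : ℝ) : policy 0 x = fun _ => 1 := by
  funext τ
  simp only [policy, add_zero]
  split_ifs <;> rfl

namespace Standing

variable (hM : M.Standing)
include hM

theorem len₁_eq {x A : ℝ} (h : M.q x = M.posterior M.pbar A) : M.len₁ x = A := by
  have h1 := (hM.survival_pos A).ne'
  have h2 := hM.pbar_pos.ne'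
  have h3 : 1 - M.pbar ≠ 0 := (sub_pos.2 hM.pbar_lt_one).ne'
  have h4 : M.pbar / (1 - M.pbar) * ((1 - M.q x) / M.q x) = Real.exp (M.lam * A) := by
    have h5 : Real.exp (M.lam * A) * Real.exp (-M.lam * A) = 1 := by
      rw [← Real.exp_add]; simp
    have h6 := (Real.exp_pos (-M.lam * A)).ne'
    rw [h, posterior_eq, eq_div_of_mul_eq h6 h5, one_sub_div h1]
    field_simp
    rw [survival]
    ring_nf
  rw [len₁, h4, Real.log_exp]
  have := hM.lam_pos.ne'
  field_simp

/-- A belief of at most the prior is reached after some amount of doing. -/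
theorem exists_posterior_eq {p : ℝ} (hp : 0 < p) (hp' : p ≤ M.pbar) :
    ∃ A, 0 ≤ A ∧ M.posterior M.pbar A = p := by
  have h1 : Tendsto (M.posterior M.pbar) atTop (𝓝 0) := by
    have h2 : Tendsto (fun A => M.pbar * Real.exp (-M.lam * A)) atTop (𝓝 (M.pbar * 0)) := by
      refine (Real.tendsto_exp_atBot.comp ?_).const_mul _
      exact tendsto_id.const_mul_atTop_of_neg (neg_neg_of_pos hM.lam_pos)
    have h3 : Tendsto M.survival atTop (𝓝 (M.pbar * 0 + 1 - M.pbar)) :=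
      (h2.add_const 1).sub_const _
    have h4 := h2.div h3 (by have := hM.pbar_lt_one; simp; linarith)
    rw [mul_zero, zero_div] at h4
    exact h4
  obtain ⟨A₁, hA₁, hA₁'⟩ := ((eventually_ge_atTop 0).and (h1.eventually_lt_const hp)).exists
  obtain ⟨A, hA, h⟩ := intermediate_value_Icc' hA₁ hM.continuous_posterior.continuousOn
    (mem_Icc.2 ⟨hA₁'.le, by rwa [posterior_zero]⟩)
  exact ⟨A, hA.1, h⟩

/-! ### The maxima taken by the algorithm exist -/

theorem mem_doOnly_iff {x : ℝ} :
    x ∈ M.doOnly ↔ 0 ≤ x ∧ ∀ t ∈ Icc 0 x, M.gap t (x - t) ≤ 0 := by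
  refine and_congr_right fun _ => forall₂_congr fun t ht => ?_
  rw [hM.gap_nonpos_iff (sub_nonneg.2 ht.2)]

theorem exists_isGreatest_doOnly : ∃ m, IsGreatest M.doOnly m := by
  have h0 : (0 : ℝ) ∈ M.doOnly := hM.mem_doOnly_iff.2 ⟨le_rfl, fun t ht => by
    rw [le_antisymm ht.2 ht.1, sub_self]; exact (hM.gap_zero_neg 0).le⟩
  have hclosed : IsClosed M.doOnly := by
    -- Writing t = ux makes the range of the parameter independent of x and exhibits an intersection
    -- of closed sets.
    have h : M.doOnly = {x | 0 ≤ x} ∩ ⋂ u ∈ Icc (0 : ℝ) 1, {x | M.gap (u * x) (x - u * x) ≤ 0} := by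
      ext x
      simp only [hM.mem_doOnly_iff, mem_inter_iff, mem_iInter₂, mem_ofPred_eq]
      refine and_congr_right fun hx => ⟨fun h u hu => h _
        ⟨mul_nonneg hu.1 hx, mul_le_of_le_one_left hx hu.2⟩, fun h t ht => ?_⟩
      rcases hx.eq_or_lt with rfl | hx
      · simpa [le_antisymm ht.2 ht.1] using h 0 ⟨le_rfl, zero_le_one⟩
      · simpa [div_mul_cancel₀ t hx.ne'] using
          h (t / x) ⟨div_nonneg ht.1 hx.le, (div_le_one hx).2 ht.2⟩
    rw [h]
    refine (isClosed_le continuous_const continuous_id).inter (isClosed_biInter fun u _ => ?_)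
    exact isClosed_le (hM.continuous_gap.comp
      (by fun_prop : Continuous fun x : ℝ => (u * x, x - u * x))) continuous_const
  have hbdd : BddAbove M.doOnly := by
    -- `denom` x is at most μcx + K, so the condition at t = 0 gives μcx(1 - p̄) ≤ p̄K.
    set K := M.mu * M.B + |M.lam - M.mu| * (|M.B| + |M.B - M.c / M.lam|) with hK
    have hk : 0 < M.mu * M.c * (1 - M.pbar) :=
      mul_pos (mul_pos hM.mu_pos hM.c_pos) (sub_pos.2 hM.pbar_lt_one)
    refine ⟨M.pbar * K / (M.mu * M.c * (1 - M.pbar)), fun x hx => ?_⟩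
    obtain ⟨hx0, hx⟩ := hM.mem_doOnly_iff.1 hx
    have h1 := hx 0 ⟨le_rfl, hx0⟩
    rw [le_div_iff₀ hk]
    have h2 : M.denom x ≤ M.mu * (M.c * x) + K := by
      have h3 : (M.lam - M.mu) * (M.B - (1 - Real.exp (-M.lam * x)) * (M.B - M.c / M.lam)) ≤
          |M.lam - M.mu| * (|M.B| + |M.B - M.c / M.lam|) := by
        refine (le_abs_self _).trans ?_
        rw [abs_mul]
        refine mul_le_mul_of_nonneg_left ((abs_sub _ _).trans ?_) (abs_nonneg _)
        rw [abs_mul]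
        have h4 : |1 - Real.exp (-M.lam * x)| ≤ 1 := by
          have h5 := Real.exp_pos (-M.lam * x)
          have h6 : Real.exp (-M.lam * x) ≤ 1 :=
            Real.exp_le_one_iff.2 (by nlinarith [hM.lam_pos])
          rw [abs_le]; constructor <;> linarith
        have := mul_le_mul_of_nonneg_right h4 (abs_nonneg (M.B - M.c / M.lam))
        linarith
      rw [denom, hK]
      linarith
    have h7 := mul_le_mul_of_nonneg_left h2 hM.pbar_pos.le
    have h8 := mul_nonneg hM.mu_pos.le (hM.V_nonneg hx0)
    simp only [gap, sub_zero, survival, mul_zero, Real.exp_zero, hM.Vext_eq hx0] at h1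
    linarith
  exact ⟨_, (hclosed.csSup_mem ⟨0, h0⟩ hbdd), fun x hx => le_csSup hbdd hx⟩

theorem exists_isGreatest_hailMary {m : ℝ} (hm : 0 ≤ m) :
    ∃ m₁, IsGreatest (M.hailMary ∩ Iic m) m₁ := by
  have h0 : (0 : ℝ) ∈ M.hailMary ∩ Iic m := by
    refine ⟨⟨le_rfl, fun t ht => ?_⟩, hm⟩
    rw [le_antisymm ht.2 ht.1, sub_self, hM.q_zero]
    simp [posterior]
  have hclosed : IsClosed (M.hailMary ∩ Iic m) := by
    have h : M.hailMary ∩ Iic m = ⋂ u ∈ Icc (0 : ℝ) 1,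
        {x ∈ Icc 0 m | M.q (x - u * x) ≤ M.posterior (M.q x) (u * x)} := by
      ext x
      simp only [mem_inter_iff, mem_iInter₂, mem_ofPred_eq, hailMary, mem_Iic]
      constructor
      · rintro ⟨⟨hx, h⟩, hxm⟩ u hu
        exact ⟨⟨hx, hxm⟩, h _ ⟨mul_nonneg hu.1 hx, mul_le_of_le_one_left hx hu.2⟩⟩
      · intro h
        obtain ⟨⟨hx, hxm⟩, h2⟩ := h 0 ⟨le_rfl, zero_le_one⟩
        refine ⟨⟨hx, fun t ht => ?_⟩, hxm⟩
        rcases hx.eq_or_lt with rfl | hx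
        · simpa [le_antisymm ht.2 ht.1] using h2
        · simpa [div_mul_cancel₀ t hx.ne'] using
            (h (t / x) ⟨div_nonneg ht.1 hx.le, (div_le_one hx).2 ht.2⟩).2
    rw [h]
    refine isClosed_biInter fun u hu => isClosed_Icc.isClosed_le ?_ ?_
    · refine hM.continuousOn_q.comp (by fun_prop) fun x hx => ?_
      exact sub_nonneg.2 (mul_le_of_le_one_left hx.1 hu.2)
    · have hq : ContinuousOn M.q (Icc 0 m) := hM.continuousOn_q.mono Icc_subset_Ici_self
      refine ContinuousOn.div (by fun_prop) (by fun_prop) fun x hx => ?_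
      have h1 := hM.q_nonneg hx.1
      have h2 : M.q x ≤ 1 := min_le_left _ _
      have h3 := Real.exp_pos (-M.lam * (u * x))
      rcases h2.eq_or_lt with h4 | h4
      · rw [h4]; simp
      · have := mul_nonneg h1 h3.le
        linarith
  exact (isCompact_Icc.of_isClosed_subset hclosed fun x hx => ⟨hx.1.1, hx.2⟩).exists_isGreatest
    ⟨0, h0⟩

/-- The final doing period of a policy that is stationary at the end of thinking. -/
theorem q_sub_le_posterior_add (hR : M.Regular) {A x : ℝ} (hA : 0 ≤ A)
    (hg : M.gap A x = 0) (hs : 0 ≤ M.slope (M.posterior M.pbar A) x) {t : ℝ} (ht : t ∈ Icc 0 x) :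
    M.q (x - t) ≤ M.posterior M.pbar (A + t) := by
  rw [← hM.gap_nonpos_iff (sub_nonneg.2 ht.2)]
  rcases ht.1.eq_or_lt with rfl | h
  · simpa using hg.le
  · exact (hM.gap_doing_neg hR hA h ht.2 hs hg.le).le

theorem mem_hailMary (hR : M.Regular) {A x : ℝ} (hA : 0 ≤ A) (hx : 0 ≤ x)
    (hg : M.gap A x = 0) (hs : 0 ≤ M.slope (M.posterior M.pbar A) x) : x ∈ M.hailMary :=
  ⟨hx, fun t ht => by
    rw [(hM.gap_eq_zero_iff hx).1 hg, hM.posterior_posterior]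
    exact hM.q_sub_le_posterior_add hR hA hg hs ht⟩

theorem mem_doOnly (hR : M.Regular) {A x : ℝ} (hA : 0 ≤ A) (hx : 0 ≤ x)
    (hg : M.gap A x = 0) (hs : 0 ≤ M.slope (M.posterior M.pbar A) x) : x ∈ M.doOnly :=
  ⟨hx, fun _ ht => (hM.q_sub_le_posterior_add hR hA hg hs ht).trans
    (hM.posterior_strictAnti.antitone (by linarith))⟩

/-- If m exceeded A + x, doing from the prior for m - x > A would leave a belief below `q x` with
time x remaining. -/
theorem le_add_of_mem_doOnly {m A x : ℝ} (hm : m ∈ M.doOnly) (hA : 0 ≤ A) (hx : 0 ≤ x)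
    (hg : M.gap A x = 0) : m ≤ A + x := by
  by_contra! h
  have h1 := hm.2 (m - x) ⟨by linarith, by linarith⟩
  rw [sub_sub_cancel, (hM.gap_eq_zero_iff hx).1 hg] at h1
  exact (hM.posterior_strictAnti (by linarith : A < m - x)).not_ge h1

/-- At the prior the slope may vanish on an interval. A least positive root before T - x would have
ŷ nondecreasing up to it, hence ŷ = 0 at half of it too, against minimality. -/
theorem thinkFirst {T x : ℝ} (hx : 0 ≤ x) (hq : M.q x = M.pbar)
    (hy : 0 ≤ M.yhat (T - x) M.pbar x) : M.ThinkFirst T x := by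
  have hy' : ∀ s ∈ Icc 0 (T - x), 0 ≤ M.yhat s M.pbar x := fun s hs =>
    hM.yhat_nonneg_of_le le_rfl hx hs.1 hs.2 hy
  refine ⟨hq, ?_, by rwa [hq]⟩
  rcases M.len₂_eq_top_or x with h | ⟨r, hr, h⟩
  · rw [h]; exact le_top
  rw [h, EReal.coe_le_coe_iff]
  by_contra! hlt
  obtain ⟨⟨hr0, hr1⟩, hmin⟩ := hr
  rw [hq] at hr1
  have hsl : 0 ≤ M.slope M.pbar (x + r) := by
    by_contra! hneg
    have := hM.yhat_lt le_rfl hx hr0.le hlt hneg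
    linarith
  have h1 := hM.yhat_le le_rfl hx (by linarith : 0 ≤ r / 2) (by linarith) hsl
  have h2 := hy' (r / 2) ⟨by linarith, by linarith⟩
  have h3 := hmin (show r / 2 ∈ M.roots x from ⟨by linarith, by rw [hq]; linarith⟩)
  linarith

theorem isLeast_roots {A Θ x : ℝ} (hA : 0 < A) (hΘ : 0 < Θ) (hx : 0 ≤ x)
    (hq : M.q x = M.posterior M.pbar A) (hy : M.yhat Θ (M.posterior M.pbar A) x = 0) :
    IsLeast (M.roots x) Θ := by
  refine ⟨⟨hΘ, by rwa [hq]⟩, fun s ⟨hs, hs'⟩ => ?_⟩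
  by_contra! hlt
  rw [hq] at hs'
  exact (hM.yhat_pos_of_lt (hM.posterior_lt hA) hx hs hlt hy.ge).ne' hs'

/-- The algorithm returns a policy of maximal gain. -/
theorem returns_of_isMaxGain (hR : M.Regular) {T α Θ : ℝ} (h : M.IsMaxGain T α Θ) (hΘ : 0 < Θ) :
    M.Returns T α Θ (T - α - Θ) := by
  obtain ⟨hα, -, -, -⟩ := id h
  obtain ⟨hx, hg⟩ := hM.pos_and_gap_eq_zero_of_isMaxGain h hΘ
  have hy := hM.yhat_nonneg_of_isMaxGain h hΘ
  have hy0 := hM.yhat_eq_zero_of_isMaxGain h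
  obtain ⟨x, hxdef⟩ : ∃ x, x = T - α - Θ := ⟨_, rfl⟩
  rw [← hxdef] at hx hg hy hy0 ⊢
  have hs := hM.slope_nonneg_of_yhat_nonneg (hM.posterior_le hα) hx.le hΘ hy
  have hq := (hM.gap_eq_zero_iff hx.le).1 hg
  obtain ⟨m, hm⟩ := hM.exists_isGreatest_doOnly
  have hxm : x ≤ m := hm.2 (hM.mem_doOnly hR hα hx.le hg hs)
  have hmE := hM.le_add_of_mem_doOnly hm.1 hα hx.le hg
  have hmT : m < T := by linarith
  refine ⟨m, hm, Or.inr ?_⟩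
  rcases hα.eq_or_lt with rfl | hα'
  · rw [posterior_zero] at hy hq
    obtain rfl : x = m := le_antisymm hxm (by linarith)
    have hΘx : Θ = T - x := by linarith
    exact Or.inl ⟨hmT, hM.thinkFirst hx.le hq (hΘx ▸ hy), rfl, hΘx, rfl⟩
  · have hy1 := hy0 hα' hΘ
    -- Passing the test would make thinking first, with final period m > x, a second stationary
    -- policy.
    have hnot : ¬ M.ThinkFirst T m := by
      rintro ⟨ht1, -, ht3⟩
      have hm0 : 0 ≤ m := hx.le.trans hxm
      have hne : x ≠ m := by
        rintro rfl
        exact (hM.posterior_lt hα').ne (hq.symm.trans ht1)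
      refine hM.stationary_unique hR le_rfl hΘ (sub_pos.2 hmT) hx.le (hxm.lt_of_ne hne)
        (by linarith) hg ((hM.gap_eq_zero_iff hm0).2 (by rw [posterior_zero, ht1])) hy1 ?_
      rw [posterior_zero, ← ht1]
      exact ht3 _ ⟨(sub_pos.2 hmT).le, le_rfl⟩
    obtain ⟨m₁, hm₁⟩ := hM.exists_isGreatest_hailMary (hx.le.trans hxm)
    have hleast := hM.isLeast_roots hα' hΘ hx.le hq hy1
    have hlen := hM.len₁_eq hq
    refine Or.inr ⟨hmT, hnot, m₁, hm₁, ⟨⟨mem_fixedPoints_iff.2 ⟨hx, Θ, hleast, ?_⟩,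
      hm₁.2 ⟨hM.mem_hailMary hR hα hx.le hg hs, hxm⟩⟩, fun y hy' => ?_⟩, hlen.symm,
      (len₂_eq_of_isLeast hleast).symm⟩
    · rw [hlen]; linarith
    -- A larger fixed point y has `q y` at most the prior, so it too comes from a stationary policy,
    -- with some past doing A ≥ 0.
    by_contra! hxy
    obtain ⟨hyf, hym₁⟩ := hy'
    obtain ⟨hy0', σ, ⟨⟨hσ, hσy⟩, -⟩, hsum⟩ := mem_fixedPoints_iff.1 hyf
    have hym : y ≤ m := le_trans hym₁ hm₁.1.2
    have hqy : M.q y ≤ M.pbar := by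
      have h1 := hm.1.2 (m - y) ⟨by linarith, by linarith⟩
      rw [sub_sub_cancel] at h1
      exact h1.trans (hM.posterior_le (by linarith))
    obtain ⟨A, hA, hAy⟩ := hM.exists_posterior_eq (hM.q_pos hy0') hqy
    rw [hM.len₁_eq hAy.symm] at hsum
    rw [← hAy] at hσy
    exact hM.stationary_unique hR hA hΘ hσ hx.le hxy (by linarith) hg
      ((hM.gap_eq_zero_iff hy0'.le).2 hAy.symm) hy1 hσy.ge

theorem returns_of_isMaxGain_zero {T α : ℝ} (hT : 0 ≤ T) (h : M.IsMaxGain T α 0) :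
    M.Returns T 0 0 T := by
  obtain ⟨m, hm⟩ := hM.exists_isGreatest_doOnly
  have hTm : T ∈ M.doOnly :=
    hM.mem_doOnly_iff.2 ⟨hT, fun t ht => hM.gap_nonpos_of_isMaxGain h ht⟩
  exact ⟨m, hm, Or.inl ⟨hm.2 hTm, rfl, rfl, rfl⟩⟩

/-! ### Optimal effort paths -/

theorem isOptimal_policy (hR : M.Regular) {T α Θ : ℝ} (h : M.IsMaxGain T α Θ) :
    M.IsOptimal T (policy Θ (T - α - Θ)) := by
  obtain ⟨hα, hΘ, hsum, hmax⟩ := h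
  have hT : 0 ≤ T := by linarith
  refine ⟨admissible_policy T _ _, fun a ha => ?_⟩
  have hb := ha.isEffortPath_indicator
  have heq : EqOn a ((Icc 0 T).indicator a) (Icc 0 T) := fun τ hτ =>
    (indicator_of_mem hτ a).symm
  obtain ⟨β, hβ, hle, -⟩ := hM.exists_payoff_le hR hT hb
  have hA0 := hb.pastDoing_sub_le T hT
  rw [pastDoing_self] at hA0
  rw [M.payoff_congr hT heq, hM.payoff_policy hα hΘ (by linarith) (by ring)]
  refine hle.trans (add_le_add_right (hmax _ _ hβ.1 ?_ ?_) _) <;> rw [pastThinking]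
  · linarith
  · linarith [hβ.2]

/-- Every optimal effort path is a policy of maximal gain. -/
theorem exists_isMaxGain_of_isOptimal (hR : M.Regular) {T : ℝ} (hT : 0 ≤ T) {a : ℝ → ℝ}
    (ha : M.IsOptimal T a) : ∃ α Θ, M.IsMaxGain T α Θ ∧
      a =ᵐ[volume.restrict (Icc 0 T)] policy Θ (T - α - Θ) := by
  have hb := ha.1.isEffortPath_indicator
  have heq : EqOn a ((Icc 0 T).indicator a) (Icc 0 T) := fun τ hτ =>
    (indicator_of_mem hτ a).symm
  set b := (Icc 0 T).indicator a with hbdef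
  obtain ⟨α, hα, hle, heqcase⟩ := hM.exists_payoff_le hR hT hb
  have hA0 := hb.pastDoing_sub_le T hT
  rw [pastDoing_self] at hA0
  have hΘ : 0 ≤ pastThinking T b 0 := by rw [pastThinking]; linarith
  have hx : T - α - pastThinking T b 0 = pastDoing T b 0 - α := by rw [pastThinking]; ring
  have hopt : ∀ α' Θ', 0 ≤ α' → 0 ≤ Θ' → α' + Θ' ≤ T →
      M.payoffDoing T + M.gain T α' Θ' ≤ M.payoff T b := fun α' Θ' h1 h2 h3 => by
    rw [← hM.payoff_policy h1 h2 (by linarith : 0 ≤ T - α' - Θ') (by ring),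
      ← M.payoff_congr hT heq]
    exact ha.2 _ (admissible_policy T _ _)
  refine ⟨α, pastThinking T b 0, ⟨hα.1, hΘ, ?_, fun α' Θ' h1 h2 h3 => ?_⟩, ?_⟩
  · have := hα.2
    linarith
  · have := hopt α' Θ' h1 h2 h3
    linarith
  · have h1 := hb.ae_eq_policy hT hα
      (heqcase (hopt _ _ hα.1 hΘ (by linarith [hα.2])))
    rw [hx]
    refine EventuallyEq.trans ?_ h1
    exact (ae_restrict_iff' measurableSet_Icc).2 (ae_of_all _ heq)

/-- The policy of maximal gain in the form in which the algorithm returns it. -/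
theorem exists_returns_of_isMaxGain (hR : M.Regular) {T : ℝ} (hT : 0 < T) {α Θ : ℝ}
    (h : M.IsMaxGain T α Θ) :
    ∃ τ₁ τ₂ τ₃, M.Returns T τ₁ τ₂ τ₃ ∧ 0 ≤ τ₁ ∧ 0 ≤ τ₂ ∧ 0 < τ₃ ∧ τ₁ + τ₂ + τ₃ = T ∧
      policy Θ (T - α - Θ) = policy τ₂ τ₃ := by
  rcases h.2.1.eq_or_lt with rfl | hΘ
  · exact ⟨0, 0, T, hM.returns_of_isMaxGain_zero hT.le h, le_rfl, le_rfl, hT, by ring,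
      by rw [policy_zero, policy_zero]⟩
  · exact ⟨α, Θ, T - α - Θ, hM.returns_of_isMaxGain hR h hΘ, h.1, hΘ.le,
      (hM.pos_and_gap_eq_zero_of_isMaxGain h hΘ).1, by ring, rfl⟩

end Standing

end Model

end DoingThinking

end

theorem proposition4 (M : DoingThinking.Model) (hM : M.Standing) (hR : M.Regular)
    (T : ℝ) (hT : 0 < T) :
    (∃! w : ℝ × ℝ × ℝ, M.Returns T w.1 w.2.1 w.2.2) ∧
    ∀ τ₁ τ₂ τ₃ : ℝ, M.Returns T τ₁ τ₂ τ₃ →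
      0 ≤ τ₁ ∧ 0 ≤ τ₂ ∧ 0 < τ₃ ∧ τ₁ + τ₂ + τ₃ = T ∧
      M.IsOptimal T (DoingThinking.Model.policy τ₂ τ₃) ∧
      ∀ a : ℝ → ℝ, M.IsOptimal T a →
        a =ᵐ[volume.restrict (Icc 0 T)] DoingThinking.Model.policy τ₂ τ₃ := by
  obtain ⟨α, Θ, hmax⟩ := hM.exists_isMaxGain hT.le
  obtain ⟨σ₁, σ₂, σ₃, hσ, h1, h2, h3, h4, h5⟩ := hM.exists_returns_of_isMaxGain hR hT hmax
  refine ⟨⟨(σ₁, σ₂, σ₃), hσ, ?_⟩, ?_⟩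
  · rintro ⟨τ₁, τ₂, τ₃⟩ hτ
    obtain ⟨rfl, rfl, rfl⟩ := hσ.unique hτ
    rfl
  · intro τ₁ τ₂ τ₃ hτ
    obtain ⟨rfl, rfl, rfl⟩ := hσ.unique hτ
    refine ⟨h1, h2, h3, h4, h5 ▸ hM.isOptimal_policy hR hmax, fun a ha => ?_⟩
    obtain ⟨β, Ξ, hmax', hae⟩ := hM.exists_isMaxGain_of_isOptimal hR hT.le ha
    -- An optimal path may come from another maximizer of the gain; uniqueness of the output
    -- identifies the two policies.
    obtain ⟨ρ₁, ρ₂, ρ₃, hρ, -, -, -, -, h6⟩ := hM.exists_returns_of_isMaxGain hR hT hmax'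
    obtain ⟨rfl, rfl, rfl⟩ := hσ.unique hρ
    rwa [h6] at hae
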